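/- **Setting.** Let $d\in\mathbb N$, $L>0$, $\mathbb T^d=\mathbb R^d/(L\mathbb Z)^d$. Let $L^2_S(\mathbb T^d)$ be the space of real $u\in L^2(\mathbb T^d)$ that are even in each coordinate, and $L^2_{ex}(\mathbb T^d)$ the space of those $u\in L^2_S(\mathbb T^d)$ that are invariant under all permutations of the coordinates. For $k\in\mathbb N^d$ ($0\in\mathbb N$) let $$\Theta(k)=\prod_{i=1}^d\sqrt{2-\delta_{k_i,0}},\qquad \omega_k(x)=\frac{\Theta(k)}{L^{d/2}}\prod_{i=1}^d\cos\Big(\frac{2\pi k_i}{L}x_i\Big),$$ let $[k]$ be the set of all permutations of $k$, and $\omega_{[k]}=\mathrm{card}([k])^{-1/2}\sum_{l\in[k]}\omega_l$. For $W\in L^2_S(\mathbb T^d)$ put $\tilde W(k)=\int_{\mathbb T^d}W\omega_k$, $W_0=\int_{\mathbb T^d}W$ and $W*u(x)=\int_{\mathbb T^d}W(x-y)u(y)\,dy$. For $\kappa>0$ consider the stationary states $\rho(x,s)$, $x\in\mathbb T^d$, $s\ge 0$ (nonnegative, smooth in $s$, with finite first moment in $s$), of $$\tau\,\partial_t\rho=-\partial_s\big[(\Phi(W*\bar\rho+B)-s)\rho\big]+\tfrac1\kappa\,\partial_s^2\rho,\qquad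 \bar\rho(x)=\int_0^\infty s\,\rho(x,s)\,ds,$$ with no flux at $s=0$, i.e. $\big(\Phi(W*\bar\rho+B)\rho-\frac1\kappa\partial_s\rho\big)|_{s=0}=0$, and $\int_0^\infty\rho(x,s)\,ds=L^{-d}$ for every $x$. Their averages $\bar\rho$ are the zeros of $$\bar{\mathcal G}(\bar\rho,\kappa)=\bar\rho-\frac1Z\int_0^\infty s\,e^{-\kappa(s-\Phi(W*\bar\rho+B))^2/2}\,ds,\qquad Z=L^d\int_0^\infty e^{-\kappa(s-\Phi(W*\bar\rho+B))^2/2}\,ds.$$ **Assumptions.** $\Phi\in C^2(\mathbb R)$, $\Phi''\ge 0$, $\Phi$ is strictly increasing on $[0,\infty)$, $\Phi\equiv0$ on $(-\infty,0]$, $B>0$, $W\in L^2_S(\mathbb T^d)$ and $W_0<0$. **Theorem.** For every $\kappa>0$ the spatially homogeneous stationary states have exactly one average, denoted $\bar\rho_\infty^\kappa\in\mathbb R$. The limit $\rho^*=\lim_{\kappa\to\infty}\bar\rho_\infty^\kappa$ exists in $\mathbb R$, and $\Phi'(W_0\rho^*+B)>0$. Write $\Phi_0=\Phi(W_0\bar\rho_\infty^\kappa+B)$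 and $\Phi_0'=\Phi'(W_0\bar\rho_\infty^\kappa+B)$, and consider, for a mode $k$ and $\kappa>0$, the bifurcation condition $$\frac{\tilde W(k)}{\Theta(k)}=\frac{1}{L^{d/2}\,\Phi_0'\Big(\frac1{L^d}-L^d\bar\rho_\infty^\kappa\big(\bar\rho_\infty^\kappa-\frac{\Phi_0}{L^d}\big)\kappa\Big)}\qquad(\ast)$$ (the denominator being nonzero). Let $k\in\mathbb N^d\setminus\{0\}$ satisfy $$\frac{\tilde W(k)}{\Theta(k)}>\frac{L^{d/2}}{\Phi'(W_0\rho^*+B)},\qquad(\ast\ast)$$ and suppose that for every $l\in\mathbb N^d\setminus\{k\}$ either $\frac{\tilde W(k)}{\Theta(k)}\ne\frac{\tilde W(l)}{\Theta(l)}$, or $W\in L^2_{ex}(\mathbb T^d)$ and $l$ is a permutation of $k$. Then there is exactly one $\kappa_0>0$ at which $(\ast)$ holds. It satisfies $\kappa_0>\frac{2|W_0|^2}{L^{2d}\pi B^2}$, and $(\bar\rho_\infty^{\kappa_0},\kappa_0)$ is a bifurcation point of $\bar{\mathcal G}=0$ in the following sense, with $(X,\omega)=(L^2_S(\mathbb T^d),\omega_k)$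 if $\frac{\tilde W(l)}{\Theta(l)}\neq\frac{\tilde W(k)}{\Theta(k)}$ for all $l\ne k$, and with $(X,\omega)=(L^2_{ex}(\mathbb T^d),\omega_{[k]})$ if $W\in L^2_{ex}(\mathbb T^d)$: there are $\delta>0$ and a $C^1$ curve $z\mapsto(u(z),\kappa(z))\in X\times(0,\infty)$, $z\in(-\delta,\delta)$, with $(u(0),\kappa(0))=(\bar\rho_\infty^{\kappa_0},\kappa_0)$ and $\bar{\mathcal G}(u(z),\kappa(z))=0$, with $u(z)$ non-constant for $z\neq0$, and $$u(z)=\bar\rho_\infty^{\kappa(z)}+z\,\omega+o(z)\quad\text{in }L^2(\mathbb T^d)\text{ as }z\to0,$$ such that all solutions $(v,\kappa)\in X\times(0,\infty)$ of $\bar{\mathcal G}(v,\kappa)=0$ in some neighbourhood of $(\bar\rho_\infty^{\kappa_0},\kappa_0)$ either have $v=\bar\rho_\infty^\kappa$ or lie on this curve. Moreover, distinct ratios give distinct bifurcation values, met one after the other as the noise $1/\kappa$ decreases: if $k,l$ satisfy $(\ast\ast)$, if $(\ast)$ holds for $k$ at $\kappa>0$ and for $l$ at $\kappa'>0$, and if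 $\frac{\tilde W(l)}{\Theta(l)}<\frac{\tilde W(k)}{\Theta(k)}$, then $\kappa<\kappa'$. -/

import Mathlib

open Set Filter Topology MeasureTheory

noncomputable section

namespace NeuralField

/-- The torus `ℝ^d / (Lℤ)^d`, with the product of the Lebesgue measures of total mass `L`. -/
abbrev Torus (d : ℕ) (L : ℝ) : Type := Fin d → AddCircle L

/-- The real Hilbert space `L²(𝕋^d)`. -/
abbrev L2 (d : ℕ) (L : ℝ) [Fact (0 < L)] : Type :=
  Lp ℝ 2 (volume : Measure (Torus d L))

/-- `L²_S(𝕋^d)`: the coordinate-wise even functions of `L²(𝕋^d)`. -/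
def L2S (d : ℕ) (L : ℝ) [Fact (0 < L)] : Set (L2 d L) :=
  {u | ∀ i : Fin d, (fun x : Torus d L => u (Function.update x i (-(x i)))) =ᵐ[volume] u}

/-- `L²_ex(𝕋^d)`: the functions of `L²_S(𝕋^d)` with exchangeable coordinates. -/
def L2ex (d : ℕ) (L : ℝ) [Fact (0 < L)] : Set (L2 d L) :=
  {u | u ∈ L2S d L ∧
    ∀ ζ : Equiv.Perm (Fin d), (fun x : Torus d L => u (x ∘ ζ)) =ᵐ[volume] u}

/-- The normalisation factor `Θ(k) = ∏ᵢ √(2 - δ_{kᵢ,0})`. -/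
def Theta {d : ℕ} (k : Fin d → ℕ) : ℝ :=
  ∏ i, √(2 - if k i = 0 then 1 else 0)

/-- The basis function `ω_k(x) = Θ(k) L^{-d/2} ∏ᵢ cos(2π kᵢ xᵢ / L)`. Here `fourier n` is the
character `x ↦ exp(2π i n x / L)` of the circle of length `L`. -/
def omega {d : ℕ} {L : ℝ} (k : Fin d → ℕ) : C(Torus d L, ℝ) where
  toFun x := Theta k / L ^ ((d : ℝ) / 2) * ∏ i, (fourier (k i : ℤ) (x i)).re
  continuous_toFun := by fun_prop

/-- The set `[k]` of all permutations of the mode `k`. -/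
def permClass {d : ℕ} (k : Fin d → ℕ) : Finset (Fin d → ℕ) :=
  Finset.univ.image fun ζ : Equiv.Perm (Fin d) => k ∘ ζ

/-- The exchangeable basis function `ω_[k] = card([k])^{-1/2} ∑_{l ∈ [k]} ω_l`. -/
def omegaEx {d : ℕ} {L : ℝ} (k : Fin d → ℕ) : C(Torus d L, ℝ) :=
  (1 / √((permClass k).card : ℝ)) • ∑ l ∈ permClass k, omega l

section Model

variable {d : ℕ} {L : ℝ} [Fact (0 < L)]

/-- A continuous function on the torus as an element of `L²(𝕋^d)`. -/
def toL2 (f : C(Torus d L, ℝ)) : L2 d L := ContinuousMap.toLp 2 volume ℝ f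

/-- The constant function `c` as an element of `L²(𝕋^d)`. -/
def constL2 (c : ℝ) : L2 d L := Lp.const 2 volume c

/-- The Fourier mode `W̃(k) = ⟨W, ω_k⟩`. -/
def fourierMode (W : L2 d L) (k : Fin d → ℕ) : ℝ := ∫ x, W x * omega k x

/-- The ratio `W̃(k) / Θ(k)`. -/
def modeRatio (W : L2 d L) (k : Fin d → ℕ) : ℝ := fourierMode W k / Theta k

/-- The mean value `W₀ = ∫ W` of the potential. -/
def meanW (W : L2 d L) : ℝ := ∫ x, W x

/-- The convolution `(W ∗ u)(x) = ∫ W(x - y) u(y) dy`. -/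
def conv (W : L2 d L) (u : Torus d L → ℝ) (x : Torus d L) : ℝ := ∫ y, W (x - y) * u y

/-- `ρ(x,s)` is a stationary state, smooth in `s`, with noise strength `σ = 1/κ`, of
`τ ∂ₜρ = -∂ₛ[(Φ(W ∗ ρ̄ + B) - s) ρ] + σ ∂ₛ²ρ` on `s > 0`, where `ρ̄(x) = ∫₀^∞ s ρ(x,s) ds`, with
the no-flux condition at `s = 0` and mass `∫₀^∞ ρ(x,s) ds = L^{-d}` at each `x`. Values of `ρ` at
`s < 0` play no role. -/
structure IsStationaryState (Φ : ℝ → ℝ) (B : ℝ) (W : L2 d L) (κ : ℝ)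
    (ρ : Torus d L → ℝ → ℝ) : Prop where
  smooth : ∀ x, ContDiffOn ℝ (⊤ : ℕ∞) (ρ x) (Ici 0)
  nonneg : ∀ x, ∀ s, 0 ≤ s → 0 ≤ ρ x s
  integrable : ∀ x, IntegrableOn (ρ x) (Ioi 0)
  mass : ∀ x, ∫ s in Ioi 0, ρ x s = 1 / L ^ d
  integrable_moment : ∀ x, IntegrableOn (fun s => s * ρ x s) (Ioi 0)
  stationary : ∀ x, ∀ s, 0 < s →
    -deriv (fun t => (Φ (conv W (fun y => ∫ r in Ioi 0, r * ρ y r) x + B) - t) * ρ x t) s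
      + 1 / κ * deriv (deriv (ρ x)) s = 0
  no_flux : ∀ x,
    Φ (conv W (fun y => ∫ r in Ioi 0, r * ρ y r) x + B) * ρ x 0
      - 1 / κ * derivWithin (ρ x) (Ici 0) 0 = 0

/-- `r` is the activity average `∫₀^∞ s ρ(s) ds` of a spatially homogeneous stationary state. -/
def IsHomogeneousMean (Φ : ℝ → ℝ) (B : ℝ) (W : L2 d L) (κ r : ℝ) : Prop :=
  ∃ ρ : ℝ → ℝ, IsStationaryState Φ B W κ (fun _ => ρ) ∧ r = ∫ s in Ioi 0, s * ρ s

/-- `ρ̄_∞^κ`, the activity average of the spatially homogeneous stationary state. It is chosen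
by `Classical.epsilon`; whenever the average exists and is unique, it is this number. -/
def rhoInf (Φ : ℝ → ℝ) (B : ℝ) (W : L2 d L) (κ : ℝ) : ℝ :=
  Classical.epsilon (IsHomogeneousMean Φ B W κ)

/-- `Z⁻¹ ∫₀^∞ s exp(-κ(s-φ)²/2) ds` with `Z = L^d ∫₀^∞ exp(-κ(s-φ)²/2) ds`. -/
def gaussMean (d : ℕ) (L κ φ : ℝ) : ℝ :=
  (∫ s in Ioi (0 : ℝ), s * Real.exp (-(κ * (s - φ) ^ 2 / 2))) /
    (L ^ d * ∫ s in Ioi (0 : ℝ), Real.exp (-(κ * (s - φ) ^ 2 / 2)))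

/-- The functional `Ḡ(ρ̄, κ) = ρ̄ - Z⁻¹ ∫₀^∞ s exp(-κ(s - Φ(W ∗ ρ̄ + B))²/2) ds`, whose zeros are
the activity averages of the stationary states. -/
def Gbar (Φ : ℝ → ℝ) (B : ℝ) (W : L2 d L) (u : L2 d L) (κ : ℝ) (x : Torus d L) : ℝ :=
  u x - gaussMean d L κ (Φ (conv W u x + B))

/-- The equation `Ḡ(u, κ) = 0` in `L²(𝕋^d)`. -/
def IsZero (Φ : ℝ → ℝ) (B : ℝ) (W : L2 d L) (u : L2 d L) (κ : ℝ) : Prop :=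
  Gbar Φ B W u κ =ᵐ[volume] 0

/-- The bifurcation condition at the mode `k`:
`W̃(k)/Θ(k) = 1 / (L^{d/2} Φ'₀ (L^{-d} - L^d ρ̄_∞ (ρ̄_∞ - Φ₀/L^d) κ))`, where
`Φ₀ = Φ(W₀ρ̄_∞ + B)` and `Φ'₀ = Φ'(W₀ρ̄_∞ + B)`. The denominator has to be nonzero. -/
def BifurcationCondition (Φ : ℝ → ℝ) (B : ℝ) (W : L2 d L) (k : Fin d → ℕ) (κ : ℝ) : Prop :=
  let r := rhoInf Φ B W κ
  let Φ₀ := Φ (meanW W * r + B)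
  let Φ₀' := deriv Φ (meanW W * r + B)
  let D := L ^ ((d : ℝ) / 2) * Φ₀' * (1 / L ^ d - L ^ d * r * (r - Φ₀ / L ^ d) * κ)
  D ≠ 0 ∧ modeRatio W k = 1 / D

/-- `(ρ̄_∞^{κ₀}, κ₀)` is a bifurcation point, in the direction `ω`, of the equation `Ḡ = 0` in the
space `X ⊆ L²(𝕋^d)`: a continuously differentiable curve `z ↦ (u z, κ z)` of solutions in `X`,
spatially non-homogeneous for `z ≠ 0` and with `u z = ρ̄_∞^{κ z} + z ω + o(z)`, crosses the branch
of homogeneous states there, and near the point every solution in `X` lies on one of the two. -/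
def IsBifurcationPoint (X : Set (L2 d L)) (Φ : ℝ → ℝ) (B : ℝ) (W ω : L2 d L) (κ₀ : ℝ) : Prop :=
  ∃ (δ : ℝ) (u : ℝ → L2 d L) (κ : ℝ → ℝ),
    0 < δ ∧
    ContDiffOn ℝ 1 u (Ioo (-δ) δ) ∧ ContDiffOn ℝ 1 κ (Ioo (-δ) δ) ∧
    u 0 = constL2 (rhoInf Φ B W κ₀) ∧ κ 0 = κ₀ ∧
    (∀ z ∈ Ioo (-δ) δ, 0 < κ z ∧ u z ∈ X ∧ IsZero Φ B W (u z) (κ z)) ∧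
    (∀ z ∈ Ioo (-δ) δ, z ≠ 0 → ∀ c : ℝ, u z ≠ constL2 c) ∧
    (fun z => u z - constL2 (rhoInf Φ B W (κ z)) - z • ω) =o[𝓝 0] (fun z : ℝ => z) ∧
    ∃ U ∈ 𝓝 ((constL2 (rhoInf Φ B W κ₀), κ₀) : L2 d L × ℝ),
      ∀ p ∈ U, p.1 ∈ X → 0 < p.2 → IsZero Φ B W p.1 p.2 →
        p.1 = constL2 (rhoInf Φ B W p.2) ∨ ∃ z ∈ Ioo (-δ) δ, p = (u z, κ z)

/-- The ratio of the mode `k` exceeds the threshold: `W̃(k)/Θ(k) > L^{d/2} / Φ'(W₀ρ* + B)`. -/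
def ExceedsThreshold (Φ : ℝ → ℝ) (B : ℝ) (W : L2 d L) (ρstar : ℝ) (k : Fin d → ℕ) : Prop :=
  L ^ ((d : ℝ) / 2) / deriv Φ (meanW W * ρstar + B) < modeRatio W k

end Model

end NeuralField

end

open NeuralField

noncomputable section

namespace NeuralField

/-! A homogeneous stationary state has no flux in s, hence is a Gaussian restricted to the half
line, and its average solves a scalar fixed point equation. With τ = log κ the right-hand side is
`response`, increasing in the input; since W₀ < 0 the equation has exactly one root, which is
continuous and nonincreasing in τ.

The linearisation of Ḡ at that root is the identity minus c(τ) times the convolution with W, where c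
is `branchSlope`. On even functions ω_k is an eigenfunction of the convolution with eigenvalue
L^{d/2} W̃(k)/Θ(k), and (∗) says that this eigenvalue times c(τ) equals 1
(`bifurcationCondition_iff`). Up to the factor L^{-d}, c is Φ₀' times the variance of a unit
Gaussian with mean √κ Φ₀ conditioned to the half line. That variance increases with the mean by
Sampford's inequality (`one_lt_mills_mul`), while Φ₀ and, by convexity, Φ₀' do not decrease along
the branch. So c is continuous, vanishes for small κ, increases strictly once it is positive and
tends to Φ'(W₀ρ* + B)/L^d. Above the threshold (∗∗) each eigenvalue therefore meets its critical
slope exactly once, and larger eigenvalues meet it at smaller κ.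

The nonlinear part is a Lyapunov–Schmidt reduction (`exists_bifurcating_curve`), arranged so that
the branch need only be continuous. Convolution maps L² compactly into the continuous functions,
which makes Ḡ a C² map and puts its linearisation under the Fredholm alternative. The kernel is
one-dimensional because the cosine modes are complete among even functions
(`eq_zero_of_inner_omega`). Both symmetry classes are fixed spaces of sets of symmetries of the
torus and are treated together in `isBifurcationPoint_of_simple_mode`. -/

/-! ### The half-line Gaussian integral and the inverse Mills ratio -/

/-- The Gaussian integral `∫_{-t}^∞ exp(-s²/2) ds`. -/
def gaussInt (t : ℝ) : ℝ := √(Real.pi / 2) + ∫ s in (0 : ℝ)..t, Real.exp (-(s ^ 2 / 2))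

lemma hasDerivAt_gaussInt (t : ℝ) : HasDerivAt gaussInt (Real.exp (-(t ^ 2 / 2))) t := by
  have hc : Continuous fun s : ℝ => Real.exp (-(s ^ 2 / 2)) := by fun_prop
  exact (intervalIntegral.integral_hasDerivAt_right (hc.intervalIntegrable _ _)
    (hc.stronglyMeasurableAtFilter _ _) hc.continuousAt).const_add _

lemma contDiff_gaussInt {n : ℕ∞} : ContDiff ℝ n gaussInt := by
  have hd : deriv gaussInt = fun t => Real.exp (-(t ^ 2 / 2)) :=
    funext fun t => (hasDerivAt_gaussInt t).deriv
  have h : ContDiff ℝ (⊤ : ℕ∞) gaussInt := by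
    rw [contDiff_infty_iff_deriv, hd]
    exact ⟨fun t => (hasDerivAt_gaussInt t).differentiableAt, by fun_prop⟩
  exact h.of_le (by exact_mod_cast le_top)

lemma gaussInt_zero : gaussInt 0 = √(Real.pi / 2) := by simp [gaussInt]

lemma monotone_gaussInt : Monotone gaussInt :=
  monotone_of_hasDerivAt_nonneg hasDerivAt_gaussInt fun _ => (Real.exp_pos _).le

lemma sqrt_le_gaussInt {t : ℝ} (ht : 0 ≤ t) : √(Real.pi / 2) ≤ gaussInt t :=
  gaussInt_zero ▸ monotone_gaussInt ht

lemma gaussInt_pos {t : ℝ} (ht : 0 ≤ t) : 0 < gaussInt t :=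
  (Real.sqrt_pos.2 (by positivity)).trans_le (sqrt_le_gaussInt ht)

lemma gaussInt_neg (t : ℝ) : gaussInt (-t) = 2 * √(Real.pi / 2) - gaussInt t := by
  have h : ∫ s in (0 : ℝ)..(-t), Real.exp (-(s ^ 2 / 2)) =
      -∫ s in (0 : ℝ)..t, Real.exp (-(s ^ 2 / 2)) := by
    have := intervalIntegral.integral_comp_neg (fun s : ℝ => Real.exp (-(s ^ 2 / 2))) (a := 0) (b := t)
    simp only [even_two, Even.neg_pow, neg_zero] at this
    rw [this, intervalIntegral.integral_symm]
  rw [gaussInt, gaussInt, h]; ring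

lemma tendsto_gaussInt_atTop : Tendsto gaussInt atTop (𝓝 (2 * √(Real.pi / 2))) := by
  have e : (fun s : ℝ => Real.exp (-(s ^ 2 / 2))) = fun s => Real.exp (-(1 / 2) * s ^ 2) := by
    ext s; ring_nf
  have h := intervalIntegral_tendsto_integral_Ioi (f := fun s : ℝ => Real.exp (-(s ^ 2 / 2)))
    (μ := volume) 0 (by rw [e]; exact (integrable_exp_neg_mul_sq (by norm_num)).integrableOn)
    tendsto_id
  have h2 : ∫ s in Ioi (0 : ℝ), Real.exp (-(s ^ 2 / 2)) = √(Real.pi / 2) := by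
    rw [e, integral_gaussian_Ioi]
    have : Real.pi / (1 / 2) = 2 ^ 2 * (Real.pi / 2) := by ring
    rw [this, Real.sqrt_mul (by norm_num), Real.sqrt_sq (by norm_num)]; ring
  rw [h2] at h
  rw [two_mul]
  exact h.const_add _

/-- The inverse Mills ratio `exp(-t²/2) / ∫_{-t}^∞ exp(-s²/2) ds`. -/
def mills (t : ℝ) : ℝ := Real.exp (-(t ^ 2 / 2)) / gaussInt t

/-- The variance of the normal law with mean `t` and unit variance, conditioned to `(0, ∞)`. -/
def truncVar (t : ℝ) : ℝ := 1 - mills t * (t + mills t)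

lemma mills_pos {t : ℝ} (ht : 0 ≤ t) : 0 < mills t := div_pos (Real.exp_pos _) (gaussInt_pos ht)

lemma hasDerivAt_mills {t : ℝ} (ht : 0 ≤ t) :
    HasDerivAt mills (-(mills t * (t + mills t))) t := by
  have h1 : HasDerivAt (fun t : ℝ => Real.exp (-(t ^ 2 / 2))) (-t * Real.exp (-(t ^ 2 / 2))) t := by
    have : HasDerivAt (fun t : ℝ => -(t ^ 2 / 2)) (-t) t := by
      exact ((hasDerivAt_pow 2 t).div_const 2).neg.congr_deriv (by simp)
    simpa [mul_comm] using this.exp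
  have h2 := h1.div (hasDerivAt_gaussInt t) (gaussInt_pos ht).ne'
  refine h2.congr_deriv ?_
  have := (gaussInt_pos ht).ne'
  unfold mills
  field_simp
  ring

lemma hasDerivAt_id_add_mills {t : ℝ} (ht : 0 ≤ t) :
    HasDerivAt (fun t => t + mills t) (truncVar t) t := by
  refine ((hasDerivAt_id t).add (hasDerivAt_mills ht)).congr_deriv ?_
  simp [truncVar]; ring

/-- In this form the sign of the derivative is decided by the last factor, which is the quantity in
Sampford's inequality. -/
lemma hasDerivAt_truncVar {t : ℝ} (ht : 0 ≤ t) :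
    HasDerivAt truncVar (mills t * ((t + mills t) * (t + 2 * mills t) - 1)) t := by
  refine (((hasDerivAt_mills ht).mul (hasDerivAt_id_add_mills ht)).const_sub 1).congr_deriv ?_
  unfold truncVar; ring

lemma mills_zero_sq : mills 0 ^ 2 = 2 / Real.pi := by
  have := Real.pi_pos
  rw [mills, gaussInt_zero]
  simp [div_pow, Real.sq_sqrt this.le]

lemma mills_zero : mills 0 = √(2 / Real.pi) := by
  rw [← mills_zero_sq, Real.sqrt_sq (mills_pos le_rfl).le]

/-- Sampford's inequality, on the half line. -/
lemma one_lt_mills_mul {t : ℝ} (ht : 0 ≤ t) : 1 < (t + mills t) * (t + 2 * mills t) := by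
  -- Write m for `mills t` and N for (t + m)(t + 2m) - 1. The rule m' = -m(t + m) gives N' + (2t +
  -- 3m) N = 2(t + m)³. The second factor has logarithmic derivative 2t + 3m, so it is the
  -- integrating factor of this equation.
  set p : ℝ → ℝ := fun t => ((t + mills t) * (t + 2 * mills t) - 1) *
    (Real.exp (t ^ 2) * gaussInt t ^ 3) with hp
  have hd : ∀ t, 0 ≤ t → HasDerivAt p (2 * (t + mills t) ^ 3 *
      (Real.exp (t ^ 2) * gaussInt t ^ 3)) t := by
    intro t ht
    have e1 : HasDerivAt (fun t : ℝ => Real.exp (t ^ 2)) (2 * t * Real.exp (t ^ 2)) t := by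
      have := (hasDerivAt_pow 2 t).exp
      simpa [mul_comm] using this
    have e2 := (hasDerivAt_gaussInt t).pow 3
    have e3 : HasDerivAt (fun t => t + 2 * mills t) (1 + 2 * -(mills t * (t + mills t))) t :=
      (hasDerivAt_id t).add ((hasDerivAt_mills ht).const_mul 2)
    have e4 := (((hasDerivAt_id_add_mills ht).mul e3).sub_const 1).mul (e1.mul e2)
    refine e4.congr_deriv ?_
    have hQ : Real.exp (-(t ^ 2 / 2)) = mills t * gaussInt t := by
      rw [mills, div_mul_cancel₀ _ (gaussInt_pos ht).ne']
    simp only [Pi.mul_apply, Pi.pow_apply]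
    rw [hQ]
    simp only [truncVar]
    push_cast
    ring
  have hmono : MonotoneOn p (Ici 0) := by
    refine monotoneOn_of_deriv_nonneg (convex_Ici 0)
      (fun t ht => (hd t ht).continuousAt.continuousWithinAt)
      (fun t ht => ((hd t (interior_subset ht)).differentiableAt).differentiableWithinAt) ?_
    intro t ht
    have ht : 0 ≤ t := interior_subset ht
    rw [(hd t ht).deriv]
    have := mills_pos ht
    have := gaussInt_pos ht
    positivity
  have h0 : 0 < p 0 := by
    have h1 : 0 < gaussInt 0 ^ 3 := pow_pos (gaussInt_pos le_rfl) 3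
    -- At t = 0 the claim reads 4/π > 1.
    have h2 : 1 < 2 * mills 0 ^ 2 := by
      rw [mills_zero_sq, ← mul_div_assoc, lt_div_iff₀ Real.pi_pos]
      linarith [Real.pi_lt_four]
    simp only [hp, zero_add, ne_eq, OfNat.ofNat_ne_zero, not_false_eq_true, zero_pow, Real.exp_zero,
      one_mul]
    exact mul_pos (by nlinarith) h1
  have h1 : 0 < p t := h0.trans_le (hmono self_mem_Ici ht ht)
  have h2 : 0 < Real.exp (t ^ 2) * gaussInt t ^ 3 :=
    mul_pos (Real.exp_pos _) (pow_pos (gaussInt_pos ht) 3)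
  have := pos_of_mul_pos_left h1 h2.le
  linarith

lemma strictMonoOn_truncVar : StrictMonoOn truncVar (Ici 0) := by
  refine strictMonoOn_of_deriv_pos (convex_Ici 0)
    (fun t ht => (hasDerivAt_truncVar ht).continuousAt.continuousWithinAt) ?_
  intro t ht
  have ht : 0 ≤ t := interior_subset ht
  rw [(hasDerivAt_truncVar ht).deriv]
  exact mul_pos (mills_pos ht) (by linarith [one_lt_mills_mul ht])

lemma deriv_truncVar_pos {t : ℝ} (ht : 0 ≤ t) :
    0 < mills t * ((t + mills t) * (t + 2 * mills t) - 1) :=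
  mul_pos (mills_pos ht) (by linarith [one_lt_mills_mul ht])

/-- By monotonicity only t = 0 matters, where the value is 1 - 2/π. -/
lemma truncVar_pos {t : ℝ} (ht : 0 ≤ t) : 0 < truncVar t := by
  have h0 : 0 < truncVar 0 := by
    have := Real.pi_gt_three
    have h := mills_zero_sq
    have : 2 / Real.pi < 1 := by rw [div_lt_one Real.pi_pos]; linarith
    simp only [truncVar, zero_add]
    nlinarith
  exact h0.trans_le (strictMonoOn_truncVar.monotoneOn self_mem_Ici ht ht)

lemma strictMonoOn_id_add_mills : StrictMonoOn (fun t => t + mills t) (Ici 0) := by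
  refine strictMonoOn_of_deriv_pos (convex_Ici 0)
    (fun t ht => (hasDerivAt_id_add_mills ht).continuousAt.continuousWithinAt) ?_
  intro t ht
  have ht : 0 ≤ t := interior_subset ht
  rw [(hasDerivAt_id_add_mills ht).deriv]
  exact truncVar_pos ht

lemma antitoneOn_mills : AntitoneOn mills (Ici 0) := by
  refine antitoneOn_of_deriv_nonpos (convex_Ici 0)
    (fun t ht => (hasDerivAt_mills ht).continuousAt.continuousWithinAt)
    (fun t ht => ((hasDerivAt_mills (interior_subset ht)).differentiableAt).differentiableWithinAt) ?_
  intro t ht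
  have ht : 0 ≤ t := interior_subset ht
  rw [(hasDerivAt_mills ht).deriv]
  have := mills_pos ht
  have : 0 ≤ mills t * (t + mills t) := by positivity
  linarith

/-- On the half line `gaussInt` is at least √(π/2), so `mills t` and `t * mills t` both inherit
Gaussian decay. -/
lemma tendsto_truncVar_atTop : Tendsto truncVar atTop (𝓝 1) := by
  have hE : Tendsto (fun t : ℝ => t * Real.exp (-(t ^ 2 / 2))) atTop (𝓝 0) := by
    have h := Real.tendsto_pow_mul_exp_neg_atTop_nhds_zero 1
    refine squeeze_zero' (eventually_ge_atTop 0 |>.mono fun t ht => by positivity) ?_ h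
    filter_upwards [eventually_ge_atTop 2] with t ht
    rw [pow_one]
    gcongr
    nlinarith
  have hs : 0 < √(Real.pi / 2) := Real.sqrt_pos.2 (by positivity)
  have h1 : Tendsto (fun t : ℝ => t * mills t) atTop (𝓝 0) := by
    have h := hE.div_const √(Real.pi / 2)
    rw [zero_div] at h
    refine squeeze_zero' (eventually_ge_atTop 0 |>.mono fun t ht =>
      mul_nonneg ht (mills_pos ht).le) ?_ h
    filter_upwards [eventually_ge_atTop 0] with t ht
    rw [mills, ← mul_div_assoc]
    gcongr
    exact sqrt_le_gaussInt ht
  have h2 : Tendsto mills atTop (𝓝 0) := by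
    refine squeeze_zero' (eventually_ge_atTop 0 |>.mono fun t ht => (mills_pos ht).le) ?_ h1
    filter_upwards [eventually_ge_atTop 1] with t ht
    have := mills_pos (zero_le_one.trans ht)
    nlinarith
  have h := (h1.add (h2.mul h2)).const_sub 1
  simp only [mul_zero, add_zero, sub_zero] at h
  refine h.congr fun t => ?_
  unfold truncVar; ring

/-! ### The mean of a Gaussian on the half line -/

lemma integrable_gauss {κ : ℝ} (hκ : 0 < κ) (φ : ℝ) :
    Integrable fun s : ℝ => Real.exp (-(κ * (s - φ) ^ 2 / 2)) := by
  have h := (integrable_exp_neg_mul_sq (b := κ / 2) (by positivity)).comp_sub_right φ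
  refine h.congr (Eventually.of_forall fun s => ?_)
  simp only; ring_nf

lemma integrable_mul_gauss {κ : ℝ} (hκ : 0 < κ) (φ : ℝ) :
    Integrable fun s : ℝ => s * Real.exp (-(κ * (s - φ) ^ 2 / 2)) := by
  have h := (integrable_mul_exp_neg_mul_sq (b := κ / 2) (by positivity)).comp_sub_right φ
  refine (h.add ((integrable_gauss hκ φ).const_mul φ)).congr (Eventually.of_forall fun s => ?_)
  simp only [Pi.add_apply]
  rw [show -(κ / 2) * (s - φ) ^ 2 = -(κ * (s - φ) ^ 2 / 2) by ring]
  ring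

lemma integral_gauss {κ : ℝ} (hκ : 0 < κ) (φ : ℝ) :
    ∫ s in Ioi (0 : ℝ), Real.exp (-(κ * (s - φ) ^ 2 / 2)) = gaussInt (√κ * φ) / √κ := by
  have hs : 0 < √κ := Real.sqrt_pos.2 hκ
  have hd : ∀ s ∈ Ici (0 : ℝ), HasDerivAt (fun s => gaussInt (√κ * (s - φ)) / √κ)
      (Real.exp (-(κ * (s - φ) ^ 2 / 2))) s := by
    intro s _
    have h1 : HasDerivAt (fun s => √κ * (s - φ)) √κ s := by
      simpa using ((hasDerivAt_id s).sub_const φ).const_mul √κ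
    have h2 := ((hasDerivAt_gaussInt (√κ * (s - φ))).comp s h1).div_const √κ
    refine h2.congr_deriv ?_
    rw [mul_div_assoc, div_self hs.ne', mul_one, mul_pow, Real.sq_sqrt hκ.le]
  have ht : Tendsto (fun s => gaussInt (√κ * (s - φ)) / √κ) atTop
      (𝓝 (2 * √(Real.pi / 2) / √κ)) := by
    refine (tendsto_gaussInt_atTop.comp ?_).div_const _
    exact Tendsto.const_mul_atTop hs (tendsto_atTop_add_const_right _ _ tendsto_id)
  rw [integral_Ioi_of_hasDerivAt_of_tendsto' hd (integrable_gauss hκ φ).integrableOn ht]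
  rw [show √κ * (0 - φ) = -(√κ * φ) by ring, gaussInt_neg]
  ring

/-- Split s = φ + (s - φ): the first part is `integral_gauss`, the second has an elementary
antiderivative. -/
lemma integral_mul_gauss {κ : ℝ} (hκ : 0 < κ) (φ : ℝ) :
    ∫ s in Ioi (0 : ℝ), s * Real.exp (-(κ * (s - φ) ^ 2 / 2)) =
      φ * (gaussInt (√κ * φ) / √κ) + Real.exp (-(κ * φ ^ 2 / 2)) / κ := by
  have hd : ∀ s ∈ Ici (0 : ℝ), HasDerivAt (fun s => -Real.exp (-(κ * (s - φ) ^ 2 / 2)) / κ)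
      ((s - φ) * Real.exp (-(κ * (s - φ) ^ 2 / 2))) s := by
    intro s _
    have h1 : HasDerivAt (fun s => -(κ * (s - φ) ^ 2 / 2)) (-(κ * (s - φ))) s := by
      have := (((((hasDerivAt_id s).sub_const φ).pow 2).const_mul κ).div_const 2).neg
      refine this.congr_deriv ?_
      simp; ring
    refine (h1.exp.neg.div_const κ).congr_deriv ?_
    field_simp
  have hi : Integrable fun s : ℝ => (s - φ) * Real.exp (-(κ * (s - φ) ^ 2 / 2)) := by
    refine ((integrable_mul_gauss hκ φ).sub ((integrable_gauss hκ φ).const_mul φ)).congr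
      (Eventually.of_forall fun s => ?_)
    simp only [Pi.sub_apply]; ring
  have ht : Tendsto (fun s => -Real.exp (-(κ * (s - φ) ^ 2 / 2)) / κ) atTop (𝓝 0) := by
    have h1 : Tendsto (fun s : ℝ => κ * (s - φ) ^ 2 / 2) atTop atTop := by
      refine Tendsto.atTop_div_const (by norm_num) (Tendsto.const_mul_atTop hκ ?_)
      exact (tendsto_pow_atTop two_ne_zero).comp
        (tendsto_atTop_add_const_right _ _ tendsto_id)
    have := ((Real.tendsto_exp_neg_atTop_nhds_zero.comp h1).neg).div_const κ
    simpa using this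
  have h := integral_Ioi_of_hasDerivAt_of_tendsto' hd hi.integrableOn ht
  have e : ∀ s : ℝ, s * Real.exp (-(κ * (s - φ) ^ 2 / 2)) =
      φ * Real.exp (-(κ * (s - φ) ^ 2 / 2)) + (s - φ) * Real.exp (-(κ * (s - φ) ^ 2 / 2)) := by
    intro s; ring
  simp_rw [e]
  rw [integral_add ((integrable_gauss hκ φ).const_mul φ).integrableOn hi.integrableOn, h,
    integral_const_mul, integral_gauss hκ]
  simp
  ring

/-- Scaling s by √κ leaves one dimensionless variable √κ φ. All later monotonicity in the input and
in the noise is read off this formula. -/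
lemma gaussMean_eq (d : ℕ) (L : ℝ) {κ φ : ℝ} (hκ : 0 < κ) (hφ : 0 ≤ φ) :
    gaussMean d L κ φ = (φ + mills (√κ * φ) / √κ) / L ^ d := by
  have hs : 0 < √κ := Real.sqrt_pos.2 hκ
  have hQ := gaussInt_pos (mul_nonneg hs.le hφ)
  rw [gaussMean, integral_gauss hκ, integral_mul_gauss hκ, mills, mul_pow, Real.sq_sqrt hκ.le,
    mul_div_assoc κ]
  rw [mul_comm (L ^ d), ← div_div]
  congr 1
  generalize gaussInt (√κ * φ) = q at hQ
  generalize Real.exp (-(κ * (φ ^ 2 / 2))) = e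
  have hk : κ = √κ * √κ := (Real.mul_self_sqrt hκ.le).symm
  generalize √κ = b at hs hk
  subst hk
  field_simp

/-! ### Spatially homogeneous stationary states -/

section Homogeneous

variable {d : ℕ} {L : ℝ} [Fact (0 < L)]

instance instIsNegInvariantTorus : (volume : Measure (Torus d L)).IsNegInvariant :=
  Measure.IsAddHaarMeasure.isNegInvariant_of_regular _

lemma conv_const (W : L2 d L) (c : ℝ) (x : Torus d L) :
    conv W (fun _ => c) x = meanW W * c := by
  rw [conv, integral_mul_const, meanW]
  congr 1
  exact integral_sub_left_eq_self (fun y => W y) volume x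

/-- A nonnegative solution of the stationary equation without flux is a Gaussian. -/
lemma eq_gauss_of_stationary {κ φ : ℝ} (hκ : 0 < κ) {ρ : ℝ → ℝ}
    (hs : ContDiffOn ℝ (⊤ : ℕ∞) ρ (Ici 0))
    (hst : ∀ s, 0 < s → -deriv (fun t => (φ - t) * ρ t) s + 1 / κ * deriv (deriv ρ) s = 0)
    (hnf : φ * ρ 0 - 1 / κ * derivWithin ρ (Ici 0) 0 = 0) :
    ∃ C : ℝ, ∀ s, 0 ≤ s → ρ s = C * Real.exp (-(κ * (s - φ) ^ 2 / 2)) := by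
  have hat : ∀ s, 0 < s → ContDiffAt ℝ (⊤ : ℕ∞) ρ s := fun s hs0 =>
    hs.contDiffAt (Ici_mem_nhds hs0)
  have hdat : ∀ s, 0 < s → HasDerivAt ρ (deriv ρ s) s := fun s hs0 =>
    ((hat s hs0).differentiableAt (by simp)).hasDerivAt
  have hddat : ∀ s, 0 < s → HasDerivAt (deriv ρ) (deriv (deriv ρ) s) s := by
    intro s hs0
    have : ContDiffAt ℝ 1 (deriv ρ) s := by
      have h := (((hat s hs0).of_le (m := 2) (WithTop.coe_le_coe.2 (le_top (a := (2 : ℕ∞))))).fderiv_right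
        (m := 1) (by norm_num)).clm_apply
        (contDiffAt_const (c := (1 : ℝ)))
      simpa only [fderiv_apply_one_eq_deriv] using h
    exact (this.differentiableAt one_ne_zero).hasDerivAt
  have hdw : ∀ s, 0 < s → derivWithin ρ (Ici 0) s = deriv ρ s := fun s hs0 =>
    derivWithin_of_mem_nhds (Ici_mem_nhds hs0)
  have hcont : ContinuousOn ρ (Ici 0) := hs.continuousOn
  have hdcont : ContinuousOn (derivWithin ρ (Ici 0)) (Ici 0) :=
    hs.continuousOn_derivWithin (uniqueDiffOn_Ici 0) (by simp)
  -- Both integrations below use this on the closed half line: continuity up to 0 lets the boundary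
  -- value be taken at s = 0, where only a one-sided derivative is available.
  have const_of : ∀ (J J' : ℝ → ℝ), ContinuousOn J (Ici 0) →
      (∀ s, 0 < s → HasDerivAt J (J' s) s) → (∀ s, 0 < s → J' s = 0) →
      ∀ s, 0 ≤ s → J s = J 0 := by
    intro J J' hc hd h0 s hs0
    have hdiff : DifferentiableOn ℝ J (interior (Ici 0)) := by
      rw [interior_Ici]
      exact fun s hs => (hd s hs).differentiableAt.differentiableWithinAt
    have hz : ∀ s ∈ interior (Ici (0 : ℝ)), deriv J s = 0 := by
      rw [interior_Ici]
      exact fun s hs => (hd s hs).deriv.trans (h0 s hs)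
    exact le_antisymm
      (antitoneOn_of_deriv_nonpos (convex_Ici 0) hc hdiff (fun s hs => (hz s hs).le)
        self_mem_Ici hs0 hs0)
      (monotoneOn_of_deriv_nonneg (convex_Ici 0) hc hdiff (fun s hs => (hz s hs).ge)
        self_mem_Ici hs0 hs0)
  have hmul : ∀ s, 0 < s → HasDerivAt (fun t => (φ - t) * ρ t)
      (-ρ s + (φ - s) * deriv ρ s) s := by
    intro s hs0
    refine (((hasDerivAt_id s).const_sub φ).mul (hdat s hs0)).congr_deriv ?_
    simp
  -- The flux is constant in s by stationarity and vanishes at 0 by the boundary condition, which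
  -- leaves a first order linear equation for ρ.
  have hJ : ∀ s, 0 ≤ s → -((φ - s) * ρ s) + 1 / κ * derivWithin ρ (Ici 0) s = 0 := by
    intro s hs0
    have := const_of (fun s => -((φ - s) * ρ s) + 1 / κ * derivWithin ρ (Ici 0) s)
      (fun s => -(-ρ s + (φ - s) * deriv ρ s) + 1 / κ * deriv (deriv ρ) s)
      (by fun_prop) ?_ ?_ s hs0
    · rw [this, sub_zero]
      linarith
    · intro s hs0
      have h1 : HasDerivAt (derivWithin ρ (Ici 0)) (deriv (deriv ρ) s) s :=
        (hddat s hs0).congr_of_eventuallyEq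
          (eventually_of_mem (Ioi_mem_nhds hs0) fun t ht => hdw t ht)
      exact (hmul s hs0).neg.add (h1.const_mul _)
    · intro s hs0
      have := hst s hs0
      rwa [(hmul s hs0).deriv] at this
  refine ⟨ρ 0 * Real.exp (κ * (0 - φ) ^ 2 / 2), fun s hs0 => ?_⟩
  have hexp : ∀ s, HasDerivAt (fun s => Real.exp (κ * (s - φ) ^ 2 / 2))
      (Real.exp (κ * (s - φ) ^ 2 / 2) * (κ * (s - φ))) s := by
    intro s
    have := ((((hasDerivAt_id s).sub_const φ).pow 2).const_mul κ).div_const 2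
    refine (this.congr_deriv (g' := κ * (s - φ)) ?_).exp
    simp
    ring
  have h := const_of (fun s => ρ s * Real.exp (κ * (s - φ) ^ 2 / 2))
    (fun s => deriv ρ s * Real.exp (κ * (s - φ) ^ 2 / 2) +
      ρ s * (Real.exp (κ * (s - φ) ^ 2 / 2) * (κ * (s - φ))))
    (by fun_prop) (fun s hs0 => (hdat s hs0).mul (hexp s)) ?_ s hs0
  · rw [← h, mul_assoc, ← Real.exp_add]
    simp
  · intro s hs0
    have h1 := hJ s hs0.le
    rw [hdw s hs0] at h1
    have h2 : deriv ρ s = κ * ((φ - s) * ρ s) := by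
      field_simp at h1
      linarith
    rw [h2]; ring

/-- Once the mean r is given, the drift is a known constant φ, so the density is a Gaussian whose
constant is fixed by the mass. The only remaining requirement is that its mean be r again. -/
lemma isHomogeneousMean_iff (Φ : ℝ → ℝ) (B : ℝ) (W : L2 d L) {κ : ℝ} (hκ : 0 < κ) (r : ℝ) :
    IsHomogeneousMean Φ B W κ r ↔ r = gaussMean d L κ (Φ (meanW W * r + B)) := by
  have hL : 0 < L ^ d := pow_pos Fact.out d
  have hI : ∀ φ, 0 < ∫ s in Ioi (0 : ℝ), Real.exp (-(κ * (s - φ) ^ 2 / 2)) := by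
    intro φ
    have : NeZero (volume.restrict (Ioi (0 : ℝ))) := ⟨by simp⟩
    exact integral_exp_pos (integrable_gauss hκ φ).integrableOn
  constructor
  · rintro ⟨ρ, hρ, hr⟩
    have x : Torus d L := 0
    set φ := Φ (meanW W * r + B) with hφ
    have hst := hρ.stationary x
    have hnf := hρ.no_flux x
    simp only [← hr, conv_const, ← hφ] at hst hnf
    obtain ⟨C, hC⟩ := eq_gauss_of_stationary hκ (hρ.smooth x) hst hnf
    have hm := hρ.mass x
    rw [setIntegral_congr_fun measurableSet_Ioi (fun s hs => hC s (le_of_lt hs)),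
      integral_const_mul] at hm
    have hr' := hr
    rw [setIntegral_congr_fun (g := fun s => C * (s * Real.exp (-(κ * (s - φ) ^ 2 / 2))))
      measurableSet_Ioi (fun s hs => by simp only [hC s (le_of_lt hs)]; ring),
      integral_const_mul] at hr'
    have hC' : C = 1 / (L ^ d * ∫ s in Ioi (0 : ℝ), Real.exp (-(κ * (s - φ) ^ 2 / 2))) := by
      have := (hI φ).ne'
      field_simp at hm ⊢
      linarith
    rw [hr', hC', gaussMean]
    ring
  · intro hr
    set φ := Φ (meanW W * r + B) with hφ
    set Z := L ^ d * ∫ s in Ioi (0 : ℝ), Real.exp (-(κ * (s - φ) ^ 2 / 2)) with hZ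
    have hZ0 : 0 < Z := mul_pos hL (hI φ)
    set ρ : ℝ → ℝ := fun s => Real.exp (-(κ * (s - φ) ^ 2 / 2)) / Z with hρ
    have hmom : r = ∫ s in Ioi 0, s * ρ s := by
      rw [hr, gaussMean, ← hZ, ← integral_div]
      simp only [hρ, mul_div_assoc]
    have hd : ∀ s, HasDerivAt ρ (κ * ((φ - s) * ρ s)) s := by
      intro s
      have := (((((hasDerivAt_id s).sub_const φ).pow 2).const_mul κ).div_const 2).neg
      refine ((this.congr_deriv (g' := -(κ * (s - φ))) ?_).exp.div_const Z).congr_deriv ?_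
      · simp; ring
      · simp only [hρ]; ring_nf; simp; ring_nf
    have hd' : deriv ρ = fun s => κ * ((φ - s) * ρ s) := funext fun s => (hd s).deriv
    refine ⟨ρ, ⟨fun _ => ?_, fun _ s _ => by positivity, fun _ => ?_, fun _ => ?_, fun _ => ?_,
      fun x s _ => ?_, fun x => ?_⟩, hmom⟩
    · exact ContDiff.contDiffOn (by simp only [hρ]; fun_prop)
    · exact ((integrable_gauss hκ φ).div_const Z).integrableOn
    · simp only [hρ]
      rw [integral_div, hZ]
      have := (hI φ).ne'
      field_simp
    · refine ((integrable_mul_gauss hκ φ).div_const Z).integrableOn.congr_fun ?_ measurableSet_Ioi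
      intro s _
      simp only [hρ]; ring
    · simp only [← hmom, conv_const, ← hφ]
      rw [hd', deriv_const_mul_field]
      field_simp
      ring
    · simp only [← hmom, conv_const, ← hφ]
      rw [((hd 0).hasDerivWithinAt).derivWithin (uniqueDiffOn_Ici 0 0 self_mem_Ici)]
      field_simp
      ring

end Homogeneous

/-! ### Bifurcation from a simple eigenvalue -/

section Bifurcation

/-- Differentiation under the integral sign: a ball around (0, b) is mapped into itself by the
dilations of the first variable with t in [0, 1], and the derivative of φ is bounded on the closed
ball by compactness. -/
lemma contDiffAt_integral_dilate_fst {φ : ℝ × ℝ → ℝ} {b : ℝ} (hφ : ContDiffAt ℝ 1 φ (0, b)) :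
    ContDiffAt ℝ 1 (fun p : ℝ × ℝ => ∫ t in (0 : ℝ)..1, φ (t * p.1, p.2)) (0, b) := by
  obtain ⟨f', u, hu, hf'c, hf'⟩ := contDiffAt_one_iff.1 hφ
  obtain ⟨r, hr, hru⟩ := Metric.nhds_basis_closedBall.mem_iff.1 hu
  obtain ⟨C, hC⟩ := (isCompact_closedBall ((0 : ℝ), b) r).exists_bound_of_continuousOn
    (hf'c.mono hru)
  have hC0 : 0 ≤ C := (norm_nonneg _).trans (hC (0, b) (Metric.mem_closedBall_self hr.le))
  let A : ℝ → (ℝ × ℝ →L[ℝ] ℝ × ℝ) := fun t =>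
    (t • ContinuousLinearMap.fst ℝ ℝ ℝ).prod (ContinuousLinearMap.snd ℝ ℝ ℝ)
  have hA : ∀ t p, A t p = (t * p.1, p.2) := fun t p => rfl
  have hAc : Continuous A := by
    have : A = fun t => t • ((ContinuousLinearMap.fst ℝ ℝ ℝ).prod 0) +
        (0 : ℝ × ℝ →L[ℝ] ℝ).prod (ContinuousLinearMap.snd ℝ ℝ ℝ) := by
      ext t <;> simp [A]
    rw [this]; fun_prop
  have hmaps : ∀ t ∈ Icc (0 : ℝ) 1, ∀ p ∈ Metric.ball ((0 : ℝ), b) r,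
      A t p ∈ Metric.ball ((0 : ℝ), b) r := by
    rintro t ⟨h0, h1⟩ ⟨x, y⟩ hp
    rw [hA]
    simp only [Metric.mem_ball, Prod.dist_eq, sup_lt_iff, Real.dist_eq, sub_zero] at hp ⊢
    refine ⟨?_, hp.2⟩
    rw [abs_mul, abs_of_nonneg h0]
    nlinarith [abs_nonneg x]
  have hnorm : ∀ t ∈ Icc (0 : ℝ) 1, ‖A t‖ ≤ 1 := by
    rintro t ⟨h0, h1⟩
    refine ContinuousLinearMap.opNorm_le_bound _ zero_le_one fun p => ?_
    rw [hA, Prod.norm_def, Prod.norm_def, one_mul, norm_mul, Real.norm_of_nonneg h0]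
    exact max_le_max (mul_le_of_le_one_left (norm_nonneg _) h1) le_rfl
  have hsub : Metric.ball ((0 : ℝ), b) r ⊆ u := Metric.ball_subset_closedBall.trans hru
  have hpc : ∀ p : ℝ × ℝ, Continuous fun t => A t p := fun p => by
    simp only [hA]; fun_prop
  have hcφ : ∀ p ∈ Metric.ball ((0 : ℝ), b) r, ContinuousOn (fun t => φ (A t p)) (Icc 0 1) :=
    fun p hp t ht => (ContinuousAt.comp (f := fun t => A t p)
      (hf' _ (hsub (hmaps t ht p hp))).continuousAt
      (hpc p).continuousAt).continuousWithinAt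
  have hcf' : ∀ p ∈ Metric.ball ((0 : ℝ), b) r,
      ContinuousOn (fun t => (f' (A t p)).comp (A t)) (Icc 0 1) := by
    intro p hp
    refine ContinuousOn.clm_comp ?_ hAc.continuousOn
    exact hf'c.comp (hpc p).continuousOn fun t ht => hsub (hmaps t ht p hp)
  have hIoc : uIoc (0 : ℝ) 1 ⊆ Icc 0 1 := by
    rw [uIoc_of_le zero_le_one]; exact Ioc_subset_Icc_self
  have hbound : ∀ t ∈ Icc (0 : ℝ) 1, ∀ p ∈ Metric.ball ((0 : ℝ), b) r,
      ‖(f' (A t p)).comp (A t)‖ ≤ C := by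
    intro t ht p hp
    refine (ContinuousLinearMap.opNorm_comp_le _ _).trans ?_
    have h1 := hC _ (Metric.ball_subset_closedBall (hmaps t ht p hp))
    have h2 := hnorm t ht
    nlinarith [norm_nonneg (A t), norm_nonneg (f' (A t p))]
  refine contDiffAt_one_iff.2 ⟨fun p => ∫ t in (0 : ℝ)..1, (f' (A t p)).comp (A t),
    Metric.ball (0, b) r, Metric.ball_mem_nhds _ hr, ?_, ?_⟩
  · intro p hp
    have hnh : Metric.ball ((0 : ℝ), b) r ∈ 𝓝 p := Metric.isOpen_ball.mem_nhds hp
    refine ContinuousAt.continuousWithinAt ?_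
    refine intervalIntegral.continuousAt_of_dominated_interval (bound := fun _ => C) ?_ ?_
      intervalIntegrable_const ?_
    · filter_upwards [hnh] with q hq
      exact ((hcf' q hq).mono hIoc).aestronglyMeasurable measurableSet_uIoc
    · filter_upwards [hnh] with q hq
      exact Eventually.of_forall fun t ht => hbound t (hIoc ht) q hq
    · refine Eventually.of_forall fun t ht => ?_
      have h1 : ContinuousAt f' (A t p) :=
        hf'c.continuousAt (mem_of_superset
          (Metric.isOpen_ball.mem_nhds (hmaps t (hIoc ht) p hp)) hsub)
      exact (h1.comp (A t).continuous.continuousAt).clm_comp continuousAt_const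
  · intro p hp
    have hnh : Metric.ball ((0 : ℝ), b) r ∈ 𝓝 p := Metric.isOpen_ball.mem_nhds hp
    refine intervalIntegral.hasFDerivAt_integral_of_dominated_of_fderiv_le (bound := fun _ => C)
      (F := fun p t => φ (t * p.1, p.2)) (F' := fun p t => (f' (A t p)).comp (A t)) hnh ?_ ?_ ?_ ?_
      (intervalIntegrable_const (μ := volume)) ?_
    · filter_upwards [hnh] with q hq
      exact ((hcφ q hq).mono hIoc).aestronglyMeasurable measurableSet_uIoc
    · exact ContinuousOn.intervalIntegrable ((hcφ p hp).mono (by rw [uIcc_of_le zero_le_one]))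
    · exact ((hcf' p hp).mono hIoc).aestronglyMeasurable measurableSet_uIoc
    · exact Eventually.of_forall fun t ht q hq => hbound t (hIoc ht) q hq
    · refine Eventually.of_forall fun t ht q hq => ?_
      exact (hf' _ (hsub (hmaps t (hIoc ht) q hq))).comp q (A t).hasFDerivAt

/-- A `C²` function of two variables that vanishes where the first one does is the product of that
variable and a `C¹` function. -/
lemma exists_eventually_eq_fst_mul {g : ℝ × ℝ → ℝ} {b : ℝ} (hg : ContDiffAt ℝ 2 g (0, b))
    (h0 : ∀ᶠ y in 𝓝 b, g (0, y) = 0) :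
    ∃ h : ℝ × ℝ → ℝ, ContDiffAt ℝ 1 h (0, b) ∧ (∀ᶠ p in 𝓝 (0, b), g p = p.1 * h p) ∧
      ∀ y, h (0, y) = fderiv ℝ g (0, y) (1, 0) := by
  have hφ : ContDiffAt ℝ 1 (fun p => fderiv ℝ g p (1, 0)) (0, b) :=
    (hg.fderiv_right (m := 1) (by norm_num)).clm_apply contDiffAt_const
  -- Hadamard's formula: h(x, y) = ∫₀¹ ∂₁g(tx, y) dt.
  refine ⟨_, contDiffAt_integral_dilate_fst hφ, ?_, fun y => by simp⟩
  have hev : ∀ᶠ p in 𝓝 ((0 : ℝ), b), ContDiffAt ℝ 2 g p := hg.eventually (by simp)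
  have h0' : ∀ᶠ p in 𝓝 ((0 : ℝ), b), g (0, p.2) = 0 := (continuousAt_snd (p := ((0 : ℝ), b))).eventually h0
  obtain ⟨r, hr, hball⟩ := Metric.eventually_nhds_iff_ball.1 hev
  filter_upwards [h0', Metric.ball_mem_nhds _ hr] with p hp0 hp
  have hmem : ∀ t ∈ uIcc (0 : ℝ) 1, (t * p.1, p.2) ∈ Metric.ball ((0 : ℝ), b) r := by
    intro t ht
    rw [uIcc_of_le zero_le_one] at ht
    simp only [Metric.mem_ball, Prod.dist_eq, sup_lt_iff, Real.dist_eq, sub_zero] at hp ⊢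
    refine ⟨?_, hp.2⟩
    rw [abs_mul, abs_of_nonneg ht.1]
    nlinarith [abs_nonneg p.1, ht.1, ht.2]
  have hd : ∀ t ∈ uIcc (0 : ℝ) 1, HasDerivAt (fun t => g (t * p.1, p.2))
      (p.1 * fderiv ℝ g (t * p.1, p.2) (1, 0)) t := by
    intro t ht
    have h1 : HasDerivAt (fun t : ℝ => (t * p.1, p.2)) (p.1, 0) t := by
      simpa using ((hasDerivAt_id t).mul_const p.1).prodMk (hasDerivAt_const t p.2)
    have h2 := ((hball _ (hmem t ht)).differentiableAt two_ne_zero).hasFDerivAt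
    refine (h2.comp_hasDerivAt t h1).congr_deriv ?_
    rw [show ((p.1, 0) : ℝ × ℝ) = p.1 • (1, 0) by simp, map_smul, smul_eq_mul]
  have hc : ContinuousOn (fun t => p.1 * fderiv ℝ g (t * p.1, p.2) (1, 0)) (uIcc 0 1) := by
    intro t ht
    have h2 := ((hball _ (hmem t ht)).fderiv_right (m := 1) (by norm_num)).continuousAt
    have h3 : ContinuousAt (fun t : ℝ => fderiv ℝ g (t * p.1, p.2)) t :=
      ContinuousAt.comp (f := fun t : ℝ => (t * p.1, p.2)) h2 (by fun_prop)
    exact (continuousAt_const.mul (h3.clm_apply continuousAt_const)).continuousWithinAt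
  have h := intervalIntegral.integral_eq_sub_of_hasDerivAt hd hc.intervalIntegrable
  rw [intervalIntegral.integral_const_mul] at h
  simp only [one_mul, zero_mul, hp0, sub_zero] at h
  exact h.symm

variable {H : Type*} [NormedAddCommGroup H] [NormedSpace ℝ H] [CompleteSpace H]

/-- Bifurcation from a simple eigenvalue along the branch `(ρ τ, τ)` of solutions of
`G (u, τ) = 0`. -/
theorem exists_bifurcating_curve {G : H × ℝ → H} (hG : ContDiff ℝ 2 G) {ρ : ℝ → H} {b : ℝ}
    (hρ : ContinuousAt ρ b) (hρ0 : ∀ τ, G (ρ τ, τ) = 0) {ℓ : H →L[ℝ] ℝ} {ω : H} (hℓω : ℓ ω = 1)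
    (hℓρ : ∀ τ, ℓ (ρ τ) = 0) {μ : ℝ → ℝ}
    (hμ : ∀ τ y, ℓ (fderiv ℝ G (ρ τ, τ) (y, 0)) = μ τ * ℓ y)
    (hμ' : ∀ a, HasDerivAt μ a b → a ≠ 0)
    (hω : fderiv ℝ G (ρ b, b) (ω, 0) = 0) (E : H ≃L[ℝ] H)
    (hE : ∀ y, E y = ℓ y • ω + fderiv ℝ G (ρ b, b) (y, 0)) :
    ∃ (δ : ℝ) (u : ℝ → H) (τ : ℝ → ℝ), 0 < δ ∧
      ContDiffOn ℝ 1 u (Ioo (-δ) δ) ∧ ContDiffOn ℝ 1 τ (Ioo (-δ) δ) ∧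
      u 0 = ρ b ∧ τ 0 = b ∧ (∀ z ∈ Ioo (-δ) δ, G (u z, τ z) = 0 ∧ ℓ (u z) = z) ∧
      (fun z => u z - ρ (τ z) - z • ω) =o[𝓝 0] (fun z : ℝ => z) ∧
      ∀ᶠ p in 𝓝 (ρ b, b), G p = 0 →
        p.1 = ρ p.2 ∨ ∃ z ∈ Ioo (-δ) δ, p = (u z, τ z) := by
  have hμb : μ b = 0 := by
    have := hμ b ω
    rwa [hω, map_zero, hℓω, mul_one, eq_comm] at this
  -- the augmented map, a local diffeomorphism
  let M : H × ℝ → H × ℝ := fun p => (ℓ p.1 • ω + (G p - ℓ (G p) • ω), p.2)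
  have hM : ContDiff ℝ 2 M := by
    have h1 : ContDiff ℝ 2 fun p : H × ℝ => ℓ p.1 := ℓ.contDiff.comp contDiff_fst
    have h2 : ContDiff ℝ 2 fun p : H × ℝ => ℓ (G p) := ℓ.contDiff.comp hG
    exact ((h1.smul contDiff_const).add (hG.sub (h2.smul contDiff_const))).prodMk contDiff_snd
  set D := fderiv ℝ G (ρ b, b) with hD
  -- The τ-derivative of the first component of `M`. It makes the derivative of `M` block
  -- triangular, with `E` and 1 on the diagonal, so inverting `E` suffices.
  let c : H := D (0, 1) - ℓ (D (0, 1)) • ω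
  let E₁ : (H × ℝ) ≃L[ℝ] (H × ℝ) :=
    ContinuousLinearEquiv.equivOfInverse
      (((E : H →L[ℝ] H).comp (ContinuousLinearMap.fst ℝ H ℝ) +
        (ContinuousLinearMap.snd ℝ H ℝ).smulRight c).prod (ContinuousLinearMap.snd ℝ H ℝ))
      (((E.symm : H →L[ℝ] H).comp (ContinuousLinearMap.fst ℝ H ℝ -
        (ContinuousLinearMap.snd ℝ H ℝ).smulRight c)).prod (ContinuousLinearMap.snd ℝ H ℝ))
      (fun p => by simp) (fun p => by simp)
  have hE₁ : ∀ p, E₁ p = (E p.1 + p.2 • c, p.2) := fun p => rfl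
  have hE₁s : ∀ p, E₁.symm p = (E.symm (p.1 - p.2 • c), p.2) := fun p => rfl
  have hMb : M (ρ b, b) = (0, b) := by simp [M, hℓρ, hρ0]
  have hMd : HasFDerivAt M (E₁ : H × ℝ →L[ℝ] H × ℝ) (ρ b, b) := by
    have hGd : HasFDerivAt G D (ρ b, b) := (hG.differentiable two_ne_zero _).hasFDerivAt
    have h1 : HasFDerivAt (fun p : H × ℝ => ℓ p.1) (ℓ.comp (ContinuousLinearMap.fst ℝ H ℝ))
        (ρ b, b) := ℓ.hasFDerivAt.comp _ hasFDerivAt_fst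
    have h2 : HasFDerivAt (fun p : H × ℝ => ℓ (G p)) (ℓ.comp D) (ρ b, b) :=
      ℓ.hasFDerivAt.comp _ hGd
    refine (((h1.smul_const ω).add (hGd.sub (h2.smul_const ω))).prodMk
      hasFDerivAt_snd).congr_fderiv ?_
    refine ContinuousLinearMap.ext fun ⟨y, t⟩ => ?_
    have hy : ℓ (D (y, 0)) = 0 := by rw [hμ, hμb, zero_mul]
    have hsplit : D (y, t) = D (y, 0) + t • D (0, 1) := by
      rw [← map_smul, ← map_add]; simp
    refine Prod.ext ?_ rfl
    simp only [ContinuousLinearMap.prod_apply, add_apply,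
      sub_apply, ContinuousLinearMap.smulRight_apply,
      ContinuousLinearMap.comp_apply, ContinuousLinearMap.coe_fst',
      ContinuousLinearEquiv.coe_coe, hE₁, hE, c, hsplit, map_add, map_smul, hy, smul_eq_mul,
      zero_add]
    module
  have hMs : HasStrictFDerivAt M (E₁ : H × ℝ →L[ℝ] H × ℝ) (ρ b, b) :=
    hM.contDiffAt.hasStrictFDerivAt' hMd two_ne_zero
  let σ : H × ℝ → H × ℝ := hMs.localInverse M E₁ (ρ b, b)
  have hσC : ContDiffAt ℝ 2 σ (0, b) := hMb ▸ hM.contDiffAt.to_localInverse hMd two_ne_zero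
  have hσb : σ (0, b) = (ρ b, b) := by rw [← hMb]; exact hMs.localInverse_apply_image
  have hσl : ∀ᶠ p in 𝓝 (ρ b, b), σ (M p) = p := hMs.eventually_left_inverse
  have hσr : ∀ᶠ q in 𝓝 ((0 : H), b), M (σ q) = q := hMb ▸ hMs.eventually_right_inverse
  have hσs : HasStrictFDerivAt σ (E₁.symm : H × ℝ →L[ℝ] H × ℝ) (0, b) :=
    hMb ▸ hMs.to_localInverse
  let j : ℝ × ℝ → H × ℝ := fun p => (p.1 • ω, p.2)
  let j' : ℝ × ℝ →L[ℝ] H × ℝ := ((ContinuousLinearMap.fst ℝ ℝ ℝ).smulRight ω).prod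
    (ContinuousLinearMap.snd ℝ ℝ ℝ)
  have hjj : j = j' := rfl
  have hj0 : j (0, b) = (0, b) := by simp [j]
  have hjc : ContinuousAt j (0, b) := hjj ▸ j'.continuous.continuousAt
  -- For given z and τ, `s (z, τ)` is the local solution with ℓ-coordinate z of all of `G = 0`
  -- except its component along ω.
  let s : ℝ × ℝ → H := fun p => (σ (j p)).1
  have hsC : ContDiffAt ℝ 2 s (0, b) := by
    refine contDiffAt_fst.comp _ (ContDiffAt.comp (0, b) ?_ (hjj ▸ j'.contDiff.contDiffAt))
    rwa [hj0]
  have hsb : s (0, b) = ρ b := by simp only [s, hj0, hσb]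
  have hss : HasStrictFDerivAt s ((ContinuousLinearMap.fst ℝ H ℝ).comp
      ((E₁.symm : H × ℝ →L[ℝ] H × ℝ).comp j')) (0, b) := by
    refine hasStrictFDerivAt_fst.comp _ (HasStrictFDerivAt.comp (0, b) ?_ ?_)
    · rwa [hj0]
    · exact hjj ▸ j'.hasStrictFDerivAt
  have hEω : E.symm ω = ω := by
    rw [ContinuousLinearEquiv.symm_apply_eq, hE, hω, hℓω, one_smul, add_zero]
  have hsj : ∀ᶠ p in 𝓝 ((0 : ℝ), b), M (s p, p.2) = (p.1 • ω, p.2) := by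
    have : ∀ᶠ p in 𝓝 ((0 : ℝ), b), M (σ (j p)) = j p := by
      have := hjc.tendsto
      rw [hj0] at this
      exact this.eventually hσr
    filter_upwards [this] with p hp
    have h2 : (σ (j p)).2 = p.2 := congrArg Prod.snd hp
    rw [← h2]
    exact hp.trans (by rw [h2])
  have hℓM : ∀ p, ℓ (M p).1 = ℓ p.1 := fun p => by simp [M, hℓω]
  have hsℓ : ∀ᶠ p in 𝓝 ((0 : ℝ), b), ℓ (s p) = p.1 := by
    filter_upwards [hsj] with p hp
    have := hℓM (s p, p.2)
    rw [hp] at this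
    simpa [hℓω] using this.symm
  -- The reduced scalar equation. It vanishes on z = 0, the trivial branch, and dividing by z leaves
  -- the equation h = 0 for the other solutions.
  let g : ℝ × ℝ → ℝ := fun p => ℓ (G (s p, p.2))
  have hsG : ∀ᶠ p in 𝓝 ((0 : ℝ), b), G (s p, p.2) = g p • ω := by
    filter_upwards [hsj, hsℓ] with p hp hp'
    have := congrArg Prod.fst hp
    simp only [M, hp', add_eq_left] at this
    exact sub_eq_zero.1 this
  have hs0 : ∀ᶠ τ in 𝓝 b, s (0, τ) = ρ τ := by
    have h1 : Tendsto (fun τ => (ρ τ, τ)) (𝓝 b) (𝓝 (ρ b, b)) :=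
      (hρ.prodMk continuousAt_id)
    filter_upwards [h1.eventually hσl] with τ hτ
    have : M (ρ τ, τ) = j (0, τ) := by simp [M, j, hℓρ, hρ0]
    simp only [s, ← this, hτ]
  have hgC : ContDiffAt ℝ 2 g (0, b) :=
    ℓ.contDiff.contDiffAt.comp _ (hG.contDiffAt.comp _ (hsC.prodMk contDiffAt_snd))
  have hg0 : ∀ᶠ τ in 𝓝 b, g (0, τ) = 0 := by
    filter_upwards [hs0] with τ hτ
    simp [g, hτ, hρ0]
  obtain ⟨h, hhC, hgh, hh0⟩ := exists_eventually_eq_fst_mul hgC hg0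
  have hline : Tendsto (fun τ : ℝ => ((0 : ℝ), τ)) (𝓝 b) (𝓝 (0, b)) :=
    (Continuous.prodMk_right (0 : ℝ)).tendsto b
  have hhμ : ∀ᶠ τ in 𝓝 b, h (0, τ) = μ τ := by
    filter_upwards [hs0, hline.eventually hsℓ.eventually_nhds,
      hline.eventually (hsC.eventually (by simp))] with τ hτ1 hτ2 hτ3
    have hsd := (hτ3.differentiableAt two_ne_zero).hasFDerivAt
    have hGd : HasFDerivAt G (fderiv ℝ G (ρ τ, τ)) (s (0, τ), τ) := by
      rw [hτ1]; exact (hG.differentiable two_ne_zero _).hasFDerivAt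
    have h1 : HasFDerivAt g _ (0, τ) := ℓ.hasFDerivAt.comp (0, τ)
      (HasFDerivAt.comp (0, τ) hGd (hsd.prodMk hasFDerivAt_snd))
    have h2 : ℓ (fderiv ℝ s (0, τ) (1, 0)) = 1 := by
      have h3 : HasFDerivAt (fun p => ℓ (s p)) _ (0, τ) := ℓ.hasFDerivAt.comp (0, τ) hsd
      have h4 : HasFDerivAt (fun p => ℓ (s p)) (ContinuousLinearMap.fst ℝ ℝ ℝ) ((0 : ℝ), τ) :=
        hasFDerivAt_fst.congr_of_eventuallyEq hτ2
      exact DFunLike.congr_fun (h3.unique h4) (1, 0)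
    rw [hh0, h1.fderiv]
    simp only [ContinuousLinearMap.comp_apply, ContinuousLinearMap.prod_apply,
      ContinuousLinearMap.coe_snd']
    rw [hμ, h2, mul_one]
  have hhb : h (0, b) = 0 := hhμ.self_of_nhds.trans hμb
  -- Near b the function μ coincides with h(0, ·), so it is differentiable at b even though the
  -- branch ρ is only assumed continuous. This is why transversality can be assumed for whatever
  -- derivative μ has.
  have hha : fderiv ℝ h (0, b) (0, 1) ≠ 0 := by
    refine hμ' _ ?_
    have h1 : HasDerivAt (fun τ : ℝ => ((0 : ℝ), τ)) (0, 1) b :=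
      (hasDerivAt_const b (0 : ℝ)).prodMk (hasDerivAt_id b)
    exact ((hhC.differentiableAt one_ne_zero).hasFDerivAt.comp_hasDerivAt b h1).congr_of_eventuallyEq
      (hhμ.mono fun _ h => h.symm)
  have hinv : (fderiv ℝ h (0, b) ∘L .inr ℝ ℝ ℝ).IsInvertible := by
    refine ⟨ContinuousLinearEquiv.unitsEquivAut ℝ (Units.mk0 _ hha), ?_⟩
    ext
    simp
  let τ := hhC.implicitFunction one_ne_zero hinv
  have hτ0 : τ 0 = b := hhC.implicitFunction_apply_self one_ne_zero hinv
  have hτh : ∀ᶠ z in 𝓝 (0 : ℝ), h (z, τ z) = 0 := by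
    have := hhC.eventually_apply_implicitFunction one_ne_zero hinv
    rwa [hhb] at this
  have hτu : ∀ᶠ p in 𝓝 ((0 : ℝ), b), h p = 0 → τ p.1 = p.2 := by
    have := hhC.eventually_apply_eq_iff_implicitFunction one_ne_zero hinv
    rw [hhb] at this
    exact this.mono fun p hp => hp.1
  have hτC : ContDiffAt ℝ 1 τ 0 := hhC.contDiffAt_implicitFunction one_ne_zero hinv
  have hγC : ContDiffAt ℝ 1 (fun z => (z, τ z)) 0 := contDiffAt_id.prodMk hτC
  have hγ : Tendsto (fun z => (z, τ z)) (𝓝 0) (𝓝 ((0 : ℝ), b)) := by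
    have := hγC.continuousAt.tendsto
    rwa [hτ0] at this
  let u : ℝ → H := fun z => s (z, τ z)
  have huC : ContDiffAt ℝ 1 u 0 := by
    refine ContDiffAt.comp (0 : ℝ) (g := s) ?_ hγC
    rw [hτ0]
    exact hsC.of_le (by norm_num)
  have hev : ∀ᶠ z in 𝓝 (0 : ℝ), ContDiffAt ℝ 1 u z ∧ ContDiffAt ℝ 1 τ z ∧
      G (u z, τ z) = 0 ∧ ℓ (u z) = z := by
    filter_upwards [huC.eventually (by simp), hτC.eventually (by simp), hτh,
      hγ.eventually hgh, hγ.eventually hsG, hγ.eventually hsℓ] with z h1 h2 h3 h4 h5 h6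
    refine ⟨h1, h2, ?_, h6⟩
    rw [show u z = s (z, τ z) from rfl]
    rw [h5, h4, h3, mul_zero, zero_smul]
  obtain ⟨δ, hδ, hball⟩ := Metric.eventually_nhds_iff_ball.1 hev
  rw [Real.ball_eq_Ioo, zero_sub, zero_add] at hball
  refine ⟨δ, u, τ, hδ, fun z hz => (hball z hz).1.contDiffWithinAt,
    fun z hz => (hball z hz).2.1.contDiffWithinAt, by simp only [u, hτ0, hsb], hτ0,
    fun z hz => (hball z hz).2.2, ?_, ?_⟩
  -- Strict differentiability of s at (0, b) compares s(z, τ z) directly with s(0, τ z) = ρ(τ z). A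
  -- derivative of ρ is never needed.
  · have h1 := hss.isLittleO
    have h2 : Tendsto (fun z => ((z, τ z), ((0 : ℝ), τ z))) (𝓝 0)
        (𝓝 (((0 : ℝ), b), ((0 : ℝ), b))) := by
      refine hγ.prodMk_nhds (hline.comp ?_)
      exact hτ0 ▸ hτC.continuousAt.tendsto
    have h3 := h1.comp_tendsto h2
    have hτt : Tendsto τ (𝓝 0) (𝓝 b) := hτ0 ▸ hτC.continuousAt.tendsto
    have h4 : ((fun p : (ℝ × ℝ) × (ℝ × ℝ) => p.1 - p.2) ∘ fun z => ((z, τ z), ((0 : ℝ), τ z)))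
        =O[𝓝 0] fun z : ℝ => z :=
      Asymptotics.IsBigO.of_bound 1 (Eventually.of_forall fun z => by simp)
    refine (h3.trans_isBigO h4).congr' ?_ EventuallyEq.rfl
    filter_upwards [hτt.eventually hs0] with z hz
    simp only [Function.comp_apply, hz, Prod.mk_sub_mk, sub_zero, sub_self,
      ContinuousLinearMap.comp_apply, ContinuousLinearMap.coe_fst']
    have : E₁.symm (j' (z, 0)) = (z • ω, 0) := by
      change E₁.symm (z • ω, 0) = _
      rw [hE₁s]; simp [hEω]
    rw [ContinuousLinearEquiv.coe_coe, this]
  -- A zero of `G` near the point has the same image under `M` as the point of the reduced surface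
  -- with its ℓ- and τ-coordinates, hence lies on that surface. There z · h = 0 gives the two
  -- alternatives.
  · have h1 : ContinuousAt (fun p : H × ℝ => (ℓ p.1, p.2)) (ρ b, b) := by fun_prop
    have h2 : Tendsto (fun p : H × ℝ => (ℓ p.1, p.2)) (𝓝 (ρ b, b)) (𝓝 (0, b)) := by
      have := h1.tendsto
      rwa [hℓρ] at this
    have h3 : Tendsto (fun p : H × ℝ => p.2) (𝓝 (ρ b, b)) (𝓝 b) := continuousAt_snd
    have h4 : Tendsto (fun p : H × ℝ => ℓ p.1) (𝓝 (ρ b, b)) (𝓝 0) :=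
      (continuous_fst.tendsto _).comp h2
    filter_upwards [hσl, h2.eventually hgh, h2.eventually hτu, h3.eventually hs0,
      h4.eventually (Ioo_mem_nhds (neg_lt_zero.2 hδ) hδ)] with p hp1 hp2 hp3 hp4 hp5 hGp
    have hMp : M p = j (ℓ p.1, p.2) := by simp [M, j, hGp]
    have hps : p.1 = s (ℓ p.1, p.2) := by
      simp only [s, ← hMp, hp1]
    have hgp : g (ℓ p.1, p.2) = 0 := by
      simp only [g]
      rw [← hps, hGp, map_zero]
    rw [hp2] at hgp
    rcases mul_eq_zero.1 hgp with hz | hz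
    · left
      rw [hz] at hps
      rw [hps]
      exact hp4
    · right
      refine ⟨ℓ p.1, hp5, ?_⟩
      have := hp3 hz
      exact Prod.ext (by simp only [u, this, ← hps]) this.symm

end Bifurcation

/-! ### Superposition operators on spaces of continuous functions -/

section Superposition

variable {K : Type*} [TopologicalSpace K] [CompactSpace K]

/-- Pointwise application of a continuous family of operators to a continuous function. -/
def pointwiseApply (K E F : Type*) [TopologicalSpace K] [CompactSpace K]
    [NormedAddCommGroup E] [NormedSpace ℝ E] [NormedAddCommGroup F] [NormedSpace ℝ F] :
    C(K, E →L[ℝ] F) →L[ℝ] C(K, E) →L[ℝ] C(K, F) :=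
  LinearMap.mkContinuous₂
    (LinearMap.mk₂ ℝ (fun (A : C(K, E →L[ℝ] F)) (w : C(K, E)) =>
        (⟨fun x => A x (w x), by fun_prop⟩ : C(K, F)))
      (fun A A' w => by ext; simp) (fun c A w => by ext; simp)
      (fun A w w' => by ext; simp) (fun c A w => by ext; simp))
    1 (fun A w => by
      rw [one_mul]
      refine (ContinuousMap.norm_le _ (by positivity)).2 fun x => ?_
      exact ((A x).le_opNorm _).trans (by gcongr <;> exact ContinuousMap.norm_coe_le_norm _ x))

@[simp]
lemma pointwiseApply_apply {E F : Type*} [NormedAddCommGroup E] [NormedSpace ℝ E]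
    [NormedAddCommGroup F] [NormedSpace ℝ F] (A : C(K, E →L[ℝ] F)) (w : C(K, E)) (x : K) :
    pointwiseApply K E F A w x = A x (w x) := rfl

/-- The mean value inequality at each x, with an error uniform in x because w ↦ f' ∘ w is continuous
for the sup norm. No growth condition on f is needed. -/
lemma hasFDerivAt_postcomp {E F : Type*} [NormedAddCommGroup E] [NormedSpace ℝ E]
    [NormedAddCommGroup F] [NormedSpace ℝ F] {f : C(E, F)} {f' : C(E, E →L[ℝ] F)}
    (hf : ∀ y, HasFDerivAt f (f' y) y) (w : C(K, E)) :
    HasFDerivAt (fun w : C(K, E) => f.comp w) (pointwiseApply K E F (f'.comp w)) w := by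
  rw [hasFDerivAt_iff_isLittleO_nhds_zero, Asymptotics.isLittleO_iff]
  intro ε hε
  have hc : ContinuousAt (fun v : C(K, E) => f'.comp v) w :=
    (ContinuousMap.continuous_postcomp f').continuousAt
  obtain ⟨δ, hδ, hδε⟩ := (Metric.continuousAt_iff (f := fun v : C(K, E) => f'.comp v)).1 hc ε hε
  filter_upwards [Metric.ball_mem_nhds (0 : C(K, E)) hδ] with h hh
  rw [mem_ball_zero_iff] at hh
  refine (ContinuousMap.norm_le _ (by positivity)).2 fun x => ?_
  have key : ∀ y ∈ segment ℝ (w x) (w x + h x), ‖f' y - f' (w x)‖ ≤ ε := by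
    intro y hy
    rw [segment_eq_image'] at hy
    obtain ⟨t, ht, rfl⟩ := hy
    have h1 : dist (w + t • h) w < δ := by
      rw [dist_eq_norm, add_sub_cancel_left, norm_smul, Real.norm_of_nonneg ht.1]
      exact (mul_le_of_le_one_left (norm_nonneg _) ht.2).trans_lt hh
    have h2 := (ContinuousMap.dist_apply_le_dist x).trans (hδε h1).le
    simpa [dist_eq_norm] using h2
  have := (convex_segment (w x) (w x + h x)).norm_image_sub_le_of_norm_hasFDerivWithin_le'
    (fun y _ => (hf y).hasFDerivWithinAt) key (left_mem_segment ℝ _ _) (right_mem_segment ℝ _ _)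
  rw [add_sub_cancel_left] at this
  refine this.trans ?_
  gcongr
  exact ContinuousMap.norm_coe_le_norm h x

/-- The derivative is again a superposition operator, with symbol f' and values in a new target
space, followed by a bounded linear map. Hence the induction, with the target quantified inside the
statement. -/
lemma contDiff_postcomp {E : Type} [NormedAddCommGroup E] [NormedSpace ℝ E] (n : ℕ) :
    ∀ {F : Type} [NormedAddCommGroup F] [NormedSpace ℝ F] {f : C(E, F)}, ContDiff ℝ n f →
      ContDiff ℝ n fun w : C(K, E) => f.comp w := by
  induction n with
  | zero =>
    intro F _ _ f _
    rw [Nat.cast_zero, contDiff_zero]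
    exact ContinuousMap.continuous_postcomp f
  | succ n ih =>
    intro F _ _ f hf
    rw [Nat.cast_succ] at hf ⊢
    obtain ⟨hd, -, hf'⟩ := contDiff_succ_iff_fderiv.1 hf
    let f' : C(E, E →L[ℝ] F) := ⟨fderiv ℝ f, hf'.continuous⟩
    have h := hasFDerivAt_postcomp (K := K) (f := f) (f' := f') fun y => (hd y).hasFDerivAt
    rw [contDiff_succ_iff_fderiv]
    refine ⟨fun w => (h w).differentiableAt, by simp, ?_⟩
    rw [show fderiv ℝ (fun w : C(K, E) => f.comp w) =
      fun w => pointwiseApply K E F (f'.comp w) from funext fun w => (h w).fderiv]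
    exact (pointwiseApply K E F).contDiff.comp (ih (f := f') hf')

end Superposition

/-! ### The convolution operator -/

section Convolution

variable {d : ℕ} {L : ℝ} [Fact (0 < L)]

/-- The translates `y ↦ W (x - y)` of the reflected potential, depending continuously on `x`. -/
def reflectTranslate (W : L2 d L) : C(Torus d L, L2 d L) where
  toFun x := Lp.compMeasurePreserving (fun y => x - y) (Measure.measurePreserving_sub_left volume x) W
  continuous_toFun := by
    let F : C(Torus d L, C(Torus d L, Torus d L)) :=
      (ContinuousMap.mk (fun p : Torus d L × Torus d L => p.1 - p.2) (by fun_prop)).curry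
    exact Continuous.compMeasurePreservingLp (f := fun _ => W) (g := F) continuous_const
      F.continuous (fun x => Measure.measurePreserving_sub_left volume x) (by simp)

lemma coeFn_reflectTranslate (W : L2 d L) (x : Torus d L) :
    reflectTranslate W x =ᵐ[volume] fun y => W (x - y) :=
  Lp.coeFn_compMeasurePreserving W (Measure.measurePreserving_sub_left volume x)

lemma norm_reflectTranslate (W : L2 d L) (x : Torus d L) : ‖reflectTranslate W x‖ = ‖W‖ :=
  Lp.norm_compMeasurePreserving W (Measure.measurePreserving_sub_left volume x)

lemma inner_eq_integral (u v : L2 d L) : inner ℝ u v = ∫ x, u x * v x := by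
  rw [L2.inner_def]
  simp [mul_comm]

lemma conv_eq_inner (W u : L2 d L) (x : Torus d L) :
    conv W u x = inner ℝ (reflectTranslate W x) u := by
  rw [inner_eq_integral, conv]
  refine integral_congr_ae ?_
  filter_upwards [coeFn_reflectTranslate W x] with y hy
  rw [hy]

/-- Convolution with `W`, from `L²` to the continuous functions. -/
def convOp (W : L2 d L) : L2 d L →L[ℝ] C(Torus d L, ℝ) :=
  LinearMap.mkContinuous
    { toFun := fun u => ⟨fun x => inner ℝ (reflectTranslate W x) u, by fun_prop⟩
      map_add' := fun u v => by ext x; simp [inner_add_right]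
      map_smul' := fun c u => by ext x; simp [inner_smul_right] }
    ‖W‖ fun u => by
      refine (ContinuousMap.norm_le _ (by positivity)).2 fun x => ?_
      rw [← norm_reflectTranslate W x]
      exact norm_inner_le_norm (reflectTranslate W x) u

lemma convOp_apply (W u : L2 d L) (x : Torus d L) : convOp W u x = conv W u x :=
  (conv_eq_inner W u x).symm

/-- Arzelà–Ascoli: translates of W depend continuously on the translation in L², so by
Cauchy–Schwarz the image of the unit ball is bounded and equicontinuous. -/
lemma isCompactOperator_convOp (W : L2 d L) : IsCompactOperator (convOp W) := by
  have hT := isCompactOperator_iff_isCompact_closure_image_closedBall 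
    (convOp W : L2 d L →ₗ[ℝ] C(Torus d L, ℝ)) one_pos
  refine hT.2 ?_
  let e := ContinuousMap.linearIsometryBoundedOfCompact (Torus d L) ℝ ℝ
  have hA : IsCompact (closure (e '' (convOp W '' Metric.closedBall 0 1))) := by
    refine BoundedContinuousFunction.arzela_ascoli (Metric.closedBall 0 ‖W‖)
      (isCompact_closedBall _ _) _ ?_ ?_
    · rintro _ x ⟨_, ⟨u, hu, rfl⟩, rfl⟩
      rw [mem_closedBall_zero_iff] at hu ⊢
      refine (norm_inner_le_norm (reflectTranslate W x) u).trans ?_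
      rw [norm_reflectTranslate]
      exact mul_le_of_le_one_right (norm_nonneg _) hu
    · intro x
      rw [Metric.equicontinuousAt_iff]
      intro ε hε
      obtain ⟨δ, hδ, h⟩ := Metric.continuousAt_iff.1
        ((reflectTranslate W).continuous.continuousAt (x := x)) ε hε
      refine ⟨δ, hδ, ?_⟩
      rintro y hy ⟨_, _, ⟨u, hu, rfl⟩, rfl⟩
      rw [mem_closedBall_zero_iff] at hu
      change dist (inner ℝ (reflectTranslate W x) u) (inner ℝ (reflectTranslate W y) u) < ε
      have h1 := h hy
      rw [dist_comm, dist_eq_norm] at h1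
      rw [dist_eq_norm, ← inner_sub_left]
      exact ((norm_inner_le_norm _ u).trans (mul_le_of_le_one_right (norm_nonneg _) hu)).trans_lt h1
  have h2 : e.toHomeomorph '' closure (convOp W '' Metric.closedBall 0 1) =
      closure (e '' (convOp W '' Metric.closedBall 0 1)) :=
    e.toHomeomorph.image_closure _
  rw [← h2, Homeomorph.isCompact_image] at hA
  exact hA

end Convolution

/-! ### Cosine modes -/

section Modes

variable {d : ℕ} {L : ℝ}

lemma Theta_pos (k : Fin d → ℕ) : 0 < Theta k :=
  Finset.prod_pos fun i _ => Real.sqrt_pos.2 (by split_ifs <;> norm_num)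

/-- The cosine `t ↦ cos(2π n t / L)` on the circle. -/
def cosMode (n : ℤ) : C(AddCircle L, ℝ) where
  toFun t := (fourier n t).re
  continuous_toFun := by fun_prop

lemma fourier_neg_right (n : ℤ) (t : AddCircle L) :
    fourier n (-t) = (starRingEnd ℂ) (fourier n t) := by
  rw [← fourier_neg, fourier_apply, fourier_apply, smul_neg, neg_smul]

lemma fourier_add_right (n : ℤ) (s t : AddCircle L) :
    fourier n (s + t) = fourier n s * fourier n t := by
  simp only [fourier_apply, smul_add, AddCircle.toCircle_add, Circle.coe_mul]

lemma cosMode_neg (n : ℤ) (t : AddCircle L) : cosMode n (-t) = cosMode n t := by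
  simp only [cosMode, ContinuousMap.coe_mk, fourier_neg_right, Complex.conj_re]

lemma cosMode_sub_add_cosMode_add (n : ℤ) (s t : AddCircle L) :
    cosMode n (s - t) + cosMode n (s + t) = 2 * (cosMode n s * cosMode n t) := by
  simp only [cosMode, ContinuousMap.coe_mk, sub_eq_add_neg, fourier_add_right, fourier_neg_right,
    Complex.mul_re, Complex.conj_re, Complex.conj_im]
  ring

lemma omega_apply (k : Fin d → ℕ) (x : Torus d L) :
    omega k x = Theta k / L ^ ((d : ℝ) / 2) * ∏ i, cosMode (k i) (x i) := rfl

lemma omega_neg (k : Fin d → ℕ) (x : Torus d L) : omega k (-x) = omega k x := by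
  simp only [omega_apply, Pi.neg_apply, cosMode_neg]

lemma omega_comp_perm (k : Fin d → ℕ) (ζ : Equiv.Perm (Fin d)) (x : Torus d L) :
    omega (k ∘ ζ) (x ∘ ζ) = omega k x := by
  have h1 : Theta (k ∘ ζ) = Theta k :=
    Equiv.prod_comp ζ fun i => √(2 - if k i = 0 then (1 : ℝ) else 0)
  rw [omega_apply, omega_apply, h1]
  congr 1
  exact Equiv.prod_comp ζ fun i => cosMode (k i) (x i)

end Modes

/-! ### Symmetries of the torus -/

section Symmetry

variable {d : ℕ} {L : ℝ} [Fact (0 < L)]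

/-- A measure preserving additive map of the torus that is a measurable embedding. -/
structure TorusSymm (d : ℕ) (L : ℝ) [Fact (0 < L)] where
  /-- The underlying map. -/
  map : Torus d L → Torus d L
  measurePreserving : MeasurePreserving map
  measurableEmbedding : MeasurableEmbedding map
  map_sub : ∀ x y, map (x - y) = map x - map y

lemma TorusSymm.integral_comp {F : Type*} [NormedAddCommGroup F] [NormedSpace ℝ F]
    (σ : TorusSymm d L) (f : Torus d L → F) : ∫ x, f (σ.map x) = ∫ x, f x :=
  σ.measurePreserving.integral_comp σ.measurableEmbedding f

/-- The reflection of the `i`-th coordinate. -/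
def flipSymm (i : Fin d) : TorusSymm d L where
  map x := Function.update x i (-(x i))
  measurePreserving := by
    have h := volume_preserving_pi (α' := fun _ : Fin d => AddCircle L)
      (β' := fun _ : Fin d => AddCircle L) (f := fun j => if j = i then fun t => -t else id) ?_
    · convert h using 2 with x
      ext j
      by_cases hj : j = i
      · subst hj; simp
      · simp [hj]
    · intro j
      by_cases hj : j = i
      · simp only [hj, if_true]; exact Measure.measurePreserving_neg volume
      · simp only [hj, if_false]; exact MeasurePreserving.id _
  measurableEmbedding := by
    have hc : Continuous fun x : Torus d L => Function.update x i (-(x i)) := by fun_prop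
    refine (hc.isClosedEmbedding (Function.LeftInverse.injective (g := fun x : Torus d L =>
      Function.update x i (-(x i))) fun x => ?_)).measurableEmbedding
    simp
  map_sub x y := by
    ext j
    by_cases hj : j = i
    · subst hj; simp; abel
    · simp [hj]

/-- The permutation `ζ` of the coordinates. -/
def permSymm (ζ : Equiv.Perm (Fin d)) : TorusSymm d L where
  map x := x ∘ ζ
  measurePreserving := by
    have h := volume_measurePreserving_piCongrLeft (fun _ : Fin d => AddCircle L) ζ.symm
    have e : (fun x : Torus d L => x ∘ ζ) =
        MeasurableEquiv.piCongrLeft (fun _ : Fin d => AddCircle L) ζ.symm := by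
      funext x j
      have := MeasurableEquiv.piCongrLeft_apply_apply (β := fun _ : Fin d => AddCircle L) ζ.symm x
        (ζ j)
      simpa using this.symm
    rw [e]
    exact h
  measurableEmbedding := by
    have hc : Continuous fun x : Torus d L => x ∘ ζ := by fun_prop
    exact (hc.isClosedEmbedding ζ.surjective.injective_comp_right).measurableEmbedding
  map_sub x y := rfl

/-- The functions of `L²` invariant under a set of symmetries. -/
def fixedSpace (S : Set (TorusSymm d L)) : Submodule ℝ (L2 d L) :=
  ⨅ σ ∈ S, LinearMap.eqLocus (Lp.compMeasurePreservingₗ ℝ σ.map σ.measurePreserving) LinearMap.id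

lemma mem_fixedSpace {S : Set (TorusSymm d L)} {u : L2 d L} :
    u ∈ fixedSpace S ↔ ∀ σ ∈ S, (fun x => u (σ.map x)) =ᵐ[volume] u := by
  simp only [fixedSpace, Submodule.mem_iInf, LinearMap.mem_eqLocus, LinearMap.id_apply]
  refine forall₂_congr fun σ _ => ?_
  have h := Lp.coeFn_compMeasurePreserving u σ.measurePreserving
  constructor
  · intro hu
    rw [show Lp.compMeasurePreserving σ.map σ.measurePreserving u = u from hu] at h
    exact h.symm
  · intro hu
    exact Lp.ext (h.trans hu)

lemma isClosed_fixedSpace (S : Set (TorusSymm d L)) : IsClosed (fixedSpace S : Set (L2 d L)) := by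
  have : (fixedSpace S : Set (L2 d L)) = ⋂ σ ∈ S,
      {u | Lp.compMeasurePreservingₗᵢ ℝ σ.map σ.measurePreserving u = u} := by
    ext u
    simp only [fixedSpace, SetLike.mem_coe, Submodule.mem_iInf, mem_iInter]
    rfl
  rw [this]
  exact isClosed_biInter fun σ _ => isClosed_eq (LinearIsometry.continuous _) continuous_id

instance (S : Set (TorusSymm d L)) : CompleteSpace (fixedSpace S) :=
  (isClosed_fixedSpace S).completeSpace_coe

lemma coe_fixedSpace_flip :
    ((fixedSpace (range flipSymm) : Submodule ℝ (L2 d L)) : Set (L2 d L)) = L2S d L := by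
  ext u
  rw [SetLike.mem_coe, mem_fixedSpace]
  simp only [forall_mem_range]
  rfl

lemma coe_fixedSpace_flip_perm :
    ((fixedSpace (range flipSymm ∪ range permSymm) : Submodule ℝ (L2 d L)) : Set (L2 d L)) = L2ex d L := by
  ext u
  rw [SetLike.mem_coe, mem_fixedSpace]
  simp only [mem_union, or_imp, forall_and, forall_mem_range]
  rfl

lemma coeFn_toL2 (f : C(Torus d L, ℝ)) : toL2 f =ᵐ[volume] f :=
  ContinuousMap.coeFn_toLp (p := 2) (𝕜 := ℝ) volume f

lemma toL2_mem_fixedSpace {S : Set (TorusSymm d L)} {f : C(Torus d L, ℝ)}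
    (hf : ∀ σ ∈ S, ∀ x, f (σ.map x) = f x) : toL2 f ∈ fixedSpace S := by
  rw [mem_fixedSpace]
  intro σ hσ
  have h := coeFn_toL2 f
  have h1 := σ.measurePreserving.quasiMeasurePreserving.ae_eq_comp h
  filter_upwards [h, h1] with x hx hx1
  simp only [Function.comp_apply] at hx1
  rw [hx1, hx, hf σ hσ]

/-- Substitute y ↦ σ(y) in the convolution integral; additivity of σ turns σ(x) - σ(y) into σ(x -
y), and then W and u absorb σ. -/
lemma convOp_comp_symm {S : Set (TorusSymm d L)} {W u : L2 d L} (hW : W ∈ fixedSpace S)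
    (hu : u ∈ fixedSpace S) {σ : TorusSymm d L} (hσ : σ ∈ S) (x : Torus d L) :
    convOp W u (σ.map x) = convOp W u x := by
  rw [convOp_apply, convOp_apply, conv, conv, ← σ.integral_comp]
  refine integral_congr_ae ?_
  have h1 := mem_fixedSpace.1 hu σ hσ
  have h2 := (Measure.measurePreserving_sub_left volume x).quasiMeasurePreserving.ae_eq_comp
    (mem_fixedSpace.1 hW σ hσ)
  filter_upwards [h1, h2] with y hy1 hy2
  simp only [Function.comp_apply] at hy2
  rw [hy1, ← hy2, σ.map_sub]

lemma toL2_convOp_mem {S : Set (TorusSymm d L)} {W u : L2 d L} (hW : W ∈ fixedSpace S)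
    (hu : u ∈ fixedSpace S) : toL2 (convOp W u) ∈ fixedSpace S :=
  toL2_mem_fixedSpace fun _ hσ x => convOp_comp_symm hW hu hσ x

lemma toL2_const (c : ℝ) : toL2 (ContinuousMap.const (Torus d L) c) = constL2 c := by
  refine Lp.ext ((coeFn_toL2 _).trans ?_)
  exact (Lp.coeFn_const _ _ _).symm

lemma constL2_mem_fixedSpace (S : Set (TorusSymm d L)) (c : ℝ) :
    (constL2 c : L2 d L) ∈ fixedSpace S := by
  rw [← toL2_const]
  exact toL2_mem_fixedSpace fun _ _ _ => rfl

/-! ### Convolution of cosine modes -/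

lemma integrable_coeFn (u : L2 d L) : Integrable u :=
  (Lp.memLp u).integrable (by norm_num)

/-- The even part of a continuous function on the circle. -/
def evenPart {𝕜 : Type*} [RCLike 𝕜] (g : C(AddCircle L, 𝕜)) : C(AddCircle L, 𝕜) where
  toFun t := (g t + g (-t)) / 2
  continuous_toFun := by fun_prop

section

variable {𝕜 : Type*} [RCLike 𝕜]

lemma integrable_smul_prod (W : L2 d L) (g : Fin d → C(AddCircle L, 𝕜)) :
    Integrable fun x : Torus d L => W x • ∏ i, g i (x i) := by
  have hc : Continuous fun x : Torus d L => ∏ i, g i (x i) := by fun_prop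
  obtain ⟨C, hC⟩ := (isCompact_univ (X := Torus d L)).exists_bound_of_continuousOn hc.continuousOn
  exact (integrable_coeFn W).smul_bdd C hc.aestronglyMeasurable
    (Eventually.of_forall fun x => hC x (mem_univ x))

/-- Reflecting coordinate a changes only the a-th factor of the product; averaging the two integrals
gives the even part. Real scalars serve the eigenfunction identity, complex ones the completeness of
the modes. -/
lemma integral_smul_prod_update_evenPart {W : L2 d L} (hW : W ∈ L2S d L)
    (g : Fin d → C(AddCircle L, 𝕜)) (a : Fin d) :
    ∫ x, W x • ∏ i, Function.update g a (evenPart (g a)) i (x i) =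
      ∫ x, W x • ∏ i, g i (x i) := by
  let P : Torus d L → 𝕜 := fun x => ∏ i ∈ Finset.univ.erase a, g i (x i)
  have h1 : ∀ (h : C(AddCircle L, 𝕜)) (x : Torus d L),
      ∏ i, Function.update g a h i (x i) = h (x a) * P x := by
    intro h x
    rw [← Finset.mul_prod_erase _ _ (Finset.mem_univ a), Function.update_self]
    congr 1
    exact Finset.prod_congr rfl fun i hi => by rw [Function.update_of_ne (Finset.ne_of_mem_erase hi)]
  have hP : ∀ x, P ((flipSymm a).map x) = P x := fun x =>
    Finset.prod_congr rfl fun i hi => by simp [flipSymm, Finset.ne_of_mem_erase hi]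
  have hg : ∀ x : Torus d L, ∏ i, g i (x i) = g a (x a) * P x := fun x => by
    rw [← h1, Function.update_eq_self]
  have hflip : ∫ x, W x • ∏ i, g i (x i) = ∫ x, W x • (g a (-(x a)) * P x) := by
    rw [← (flipSymm a).integral_comp]
    refine integral_congr_ae ?_
    filter_upwards [hW a] with x hx
    rw [hg, hP]
    change W (Function.update x a (-(x a))) • _ = _
    rw [hx]
    simp [flipSymm]
  have hint : Integrable fun x => W x • (g a (-(x a)) * P x) := by
    have := integrable_smul_prod W (Function.update g a ((g a).comp ⟨fun t => -t, by fun_prop⟩))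
    simp only [h1] at this
    exact this
  have hint' : Integrable fun x => W x • (g a (x a) * P x) := by
    simpa only [hg] using integrable_smul_prod W g
  have h2 : ∀ x : Torus d L, W x • ∏ i, Function.update g a (evenPart (g a)) i (x i) =
      (1 / 2 : ℝ) • (W x • (g a (x a) * P x) + W x • (g a (-(x a)) * P x)) := by
    intro x
    rw [h1]
    simp only [evenPart, ContinuousMap.coe_mk, RCLike.real_smul_eq_coe_mul]
    push_cast
    ring
  simp_rw [h2]
  rw [integral_smul, integral_add hint' hint, ← hflip]
  simp_rw [hg]
  rw [← two_smul ℝ, smul_smul]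
  norm_num

/-- Against an even function, a product of functions of one coordinate may be replaced by the
product of the even parts. -/
lemma integral_smul_prod_evenPart {W : L2 d L} (hW : W ∈ L2S d L)
    (g : Fin d → C(AddCircle L, 𝕜)) :
    ∫ x, W x • ∏ i, evenPart (g i) (x i) = ∫ x, W x • ∏ i, g i (x i) := by
  have h : ∀ s : Finset (Fin d),
      ∫ x, W x • ∏ i, (if i ∈ s then evenPart (g i) else g i) (x i) =
        ∫ x, W x • ∏ i, g i (x i) := by
    intro s
    induction s using Finset.induction_on with
    | empty => simp
    | insert a s ha ih =>
      refine Eq.trans ?_ ((integral_smul_prod_update_evenPart hW _ a).trans ih)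
      refine integral_congr_ae (Eventually.of_forall fun x => ?_)
      simp only
      congr 1
      refine Finset.prod_congr rfl fun i _ => ?_
      by_cases hi : i = a
      · subst hi; simp [ha]
      · simp [hi]
  simpa using h Finset.univ

end

lemma rpow_half_pos : 0 < L ^ ((d : ℝ) / 2) := Real.rpow_pos_of_pos Fact.out _

lemma rpow_half_mul_self : L ^ ((d : ℝ) / 2) * L ^ ((d : ℝ) / 2) = L ^ d := by
  rw [← Real.rpow_add Fact.out, add_halves, Real.rpow_natCast]

/-- The mode `ω_k` is an eigenfunction of the convolution with an even potential. -/
lemma integral_mul_omega_sub {W : L2 d L} (hW : W ∈ L2S d L) (k : Fin d → ℕ) (x : Torus d L) :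
    ∫ z, W z * omega k (x - z) = L ^ ((d : ℝ) / 2) * modeRatio W k * omega k x := by
  -- The even part in t of cos(x - t) is cos x cos t, so the x-dependence leaves the integral.
  let g : Fin d → C(AddCircle L, ℝ) := fun i => ⟨fun t => cosMode (k i) (x i - t), by fun_prop⟩
  have h := integral_smul_prod_evenPart hW g
  have he : ∀ i t, evenPart (g i) t = cosMode (k i) (x i) * cosMode (k i) t := by
    intro i t
    have := cosMode_sub_add_cosMode_add (k i : ℤ) (x i) t
    simp only [evenPart, ContinuousMap.coe_mk, g, sub_neg_eq_add]
    linarith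
  simp only [he, Finset.prod_mul_distrib, smul_eq_mul] at h
  have h1 : ∫ z, W z * omega k (x - z) =
      Theta k / L ^ ((d : ℝ) / 2) * ∫ z, W z * ∏ i, g i (z i) := by
    rw [← integral_const_mul]
    refine integral_congr_ae (Eventually.of_forall fun z => ?_)
    simp only [omega_apply, g, ContinuousMap.coe_mk, Pi.sub_apply]
    ring
  have h2 : fourierMode W k = Theta k / L ^ ((d : ℝ) / 2) *
      ∫ z, W z * ∏ i, cosMode (k i) (z i) := by
    rw [← integral_const_mul, fourierMode]
    refine integral_congr_ae (Eventually.of_forall fun z => ?_)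
    simp only [omega_apply]
    ring
  have h3 : ∫ z, W z * ((∏ i, cosMode (k i) (x i)) * ∏ i, cosMode (k i) (z i)) =
      (∏ i, cosMode (k i) (x i)) * ∫ z, W z * ∏ i, cosMode (k i) (z i) := by
    rw [← integral_const_mul]
    refine integral_congr_ae (Eventually.of_forall fun z => ?_)
    simp only
    ring
  rw [h1, ← h, h3, modeRatio, h2, omega_apply]
  have := Theta_pos k
  have := rpow_half_pos (d := d) (L := L)
  field_simp

lemma convOp_omega {W : L2 d L} (hW : W ∈ L2S d L) (k : Fin d → ℕ) :
    convOp W (toL2 (omega k)) = (L ^ ((d : ℝ) / 2) * modeRatio W k) • omega k := by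
  ext x
  rw [convOp_apply, conv, ContinuousMap.smul_apply, smul_eq_mul, ← integral_mul_omega_sub hW]
  rw [← integral_sub_left_eq_self (fun z => W z * omega k (x - z)) volume x]
  refine integral_congr_ae ?_
  filter_upwards [coeFn_toL2 (omega k)] with y hy
  rw [hy, sub_sub_cancel]

/-- Fubini moves the convolution onto the even function ω_k. Here v is arbitrary in L², so the
projection onto ω_k intertwines with the convolution on the whole space. -/
lemma inner_toL2_convOp_omega {W : L2 d L} (hW : W ∈ L2S d L) (v : L2 d L) (k : Fin d → ℕ) :
    inner ℝ (toL2 (omega k)) (toL2 (convOp W v)) =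
      L ^ ((d : ℝ) / 2) * modeRatio W k * inner ℝ (toL2 (omega k)) v := by
  have h1 : inner ℝ (toL2 (omega k)) (toL2 (convOp W v)) =
      ∫ x, ∫ y, v y * W (x - y) * omega k x := by
    rw [inner_eq_integral]
    refine integral_congr_ae ?_
    filter_upwards [coeFn_toL2 (omega k), coeFn_toL2 (convOp W v)] with x hx1 hx2
    rw [hx1, hx2, convOp_apply, conv, integral_mul_const, mul_comm]
    simp only [mul_comm]
  have hint : Integrable (fun p : Torus d L × Torus d L => v p.2 * W (p.1 - p.2) * omega k p.1)
      (volume.prod volume) := by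
    have := (integrable_coeFn v).convolution_integrand (ContinuousLinearMap.mul ℝ ℝ)
      (integrable_coeFn W)
    obtain ⟨C, hC⟩ := (isCompact_univ (X := Torus d L)).exists_bound_of_continuousOn
      (omega k : C(Torus d L, ℝ)).continuous.continuousOn
    exact this.mul_bdd (c := C)
      ((omega k : C(Torus d L, ℝ)).continuous.comp continuous_fst).aestronglyMeasurable
      (Eventually.of_forall fun p => hC p.1 (mem_univ _))
  rw [h1, integral_integral_swap hint, inner_eq_integral, ← integral_const_mul]
  refine integral_congr_ae ?_
  filter_upwards [coeFn_toL2 (omega k)] with y hy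
  rw [hy]
  have h2 : ∫ x, v y * W (x - y) * omega k x = v y * ∫ x, W (x - y) * omega k x := by
    rw [← integral_const_mul]
    simp only [mul_assoc]
  have h3 : ∫ x, W (x - y) * omega k x = ∫ z, W z * omega k (-y - z) := by
    rw [← integral_sub_right_eq_self (fun z => W z * omega k (-y - z)) y]
    refine integral_congr_ae (Eventually.of_forall fun x => ?_)
    simp only
    rw [show -y - (x - y) = -x by abel, omega_neg]
  rw [h2, h3, integral_mul_omega_sub hW, omega_neg]
  ring

end Symmetry

/-! ### Exchangeable modes -/

section ExchangeableModes

variable {d : ℕ} {L : ℝ}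

lemma cosMode_zero_right (n : ℤ) : cosMode n (0 : AddCircle L) = 1 := by
  simp [cosMode]

lemma mem_permClass {k l : Fin d → ℕ} :
    l ∈ permClass k ↔ ∃ ζ : Equiv.Perm (Fin d), l = k ∘ ζ := by
  simp [permClass, eq_comm]

lemma self_mem_permClass (k : Fin d → ℕ) : k ∈ permClass k := mem_permClass.2 ⟨1, rfl⟩

lemma omegaEx_apply (k : Fin d → ℕ) (x : Torus d L) :
    omegaEx k x = (1 / √((permClass k).card : ℝ)) * ∑ l ∈ permClass k, omega l x := by
  simp [omegaEx, ContinuousMap.smul_apply]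

lemma permClass_image_comp (k : Fin d → ℕ) (ζ : Equiv.Perm (Fin d)) {l : Fin d → ℕ}
    (hl : l ∈ permClass k) : l ∘ ζ ∈ permClass k := by
  obtain ⟨ξ, rfl⟩ := mem_permClass.1 hl
  exact mem_permClass.2 ⟨ζ.trans ξ, rfl⟩

lemma omegaEx_comp_perm (k : Fin d → ℕ) (ζ : Equiv.Perm (Fin d)) (x : Torus d L) :
    omegaEx k (x ∘ ζ) = omegaEx k x := by
  rw [omegaEx_apply, omegaEx_apply]
  congr 1
  refine Finset.sum_bij' (fun l _ => l ∘ ζ.symm) (fun l _ => l ∘ ζ)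
    (fun l hl => permClass_image_comp k _ hl) (fun l hl => permClass_image_comp k _ hl)
    (fun l _ => by ext; simp) (fun l _ => by ext; simp) fun l _ => ?_
  have := omega_comp_perm (l ∘ ζ.symm) ζ x
  rwa [Function.comp_assoc, Equiv.symm_comp_self, Function.comp_id] at this

end ExchangeableModes

/-! ### Completeness of the cosine modes -/

section Characters

variable {d : ℕ} {L : ℝ}

/-- The characters of the torus. -/
def torusChar (L : ℝ) (n : Fin d → ℤ) : C(Torus d L, ℂ) where
  toFun x := ∏ i, fourier (n i) (x i)
  continuous_toFun := by fun_prop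

lemma torusChar_neg (n : Fin d → ℤ) (x : Torus d L) :
    torusChar L (-n) x = (starRingEnd ℂ) (torusChar L n x) := by
  simp only [torusChar, Pi.neg_apply, fourier_neg, ContinuousMap.coe_mk, map_prod]

lemma torusChar_add (m n : Fin d → ℤ) : torusChar L (m + n) = torusChar L m * torusChar L n := by
  ext x
  simp only [torusChar, Pi.add_apply, fourier_add, ContinuousMap.coe_mk, ContinuousMap.mul_apply,
    Finset.prod_mul_distrib]

lemma torusChar_zero : torusChar L (0 : Fin d → ℤ) = 1 := by
  ext x
  simp only [torusChar, Pi.zero_apply, fourier_zero, Finset.prod_const_one, ContinuousMap.coe_mk,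
    ContinuousMap.one_apply]

lemma torusChar_single (i : Fin d) (x : Torus d L) :
    torusChar L (Pi.single i 1) x = fourier 1 (x i) := by
  simp only [torusChar, ContinuousMap.coe_mk]
  rw [Finset.prod_eq_single i (fun j _ hj => by rw [Pi.single_eq_of_ne hj, fourier_zero])
    (by simp), Pi.single_eq_same]

lemma evenPart_fourier (n : ℤ) (t : AddCircle L) :
    evenPart (fourier n : C(AddCircle L, ℂ)) t = ((cosMode n.natAbs t : ℝ) : ℂ) := by
  have h : cosMode (n.natAbs : ℤ) t = cosMode n t := by
    rcases Int.natAbs_eq n with h | h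
    · rw [← h]
    · conv_rhs => rw [h]
      simp only [cosMode, ContinuousMap.coe_mk, fourier_neg, Complex.conj_re]
  rw [h]
  simp only [evenPart, ContinuousMap.coe_mk, fourier_neg_right, cosMode, Complex.add_conj]
  push_cast
  ring

variable [Fact (0 < L)]

/-- Stone–Weierstrass. Characters are closed under products, so the algebra they generate is their
span, and those of a single coordinate already separate points. -/
lemma span_torusChar_closure_eq_top :
    (Submodule.span ℂ (range (torusChar (d := d) L))).topologicalClosure = ⊤ := by
  let A : StarSubalgebra ℂ C(Torus d L, ℂ) :=
    { toSubalgebra := Algebra.adjoin ℂ (range (torusChar L))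
      star_mem' := by
        change Algebra.adjoin ℂ (range (torusChar L)) ≤
          star (Algebra.adjoin ℂ (range (torusChar (d := d) L)))
        refine Algebra.adjoin_le ?_
        rintro _ ⟨n, rfl⟩
        refine Algebra.subset_adjoin ⟨-n, ?_⟩
        ext1 x
        simp only [torusChar_neg, starRingEnd_apply, ContinuousMap.star_apply] }
  have hspan : A.toSubalgebra.toSubmodule = Submodule.span ℂ (range (torusChar L)) := by
    apply Algebra.adjoin_eq_span_of_subset
    refine Subset.trans (fun x => Submonoid.closure_induction (fun _ => id) ⟨0, torusChar_zero⟩ ?_)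
      Submodule.subset_span
    rintro _ _ _ _ ⟨m, rfl⟩ ⟨n, rfl⟩
    exact ⟨m + n, torusChar_add m n⟩
  have hsep : A.SeparatesPoints := by
    intro x y hxy
    obtain ⟨i, hi⟩ := Function.ne_iff.1 hxy
    refine ⟨_, ⟨torusChar L (Pi.single i 1), Algebra.subset_adjoin ⟨_, rfl⟩, rfl⟩, ?_⟩
    simp only [torusChar_single, fourier_one, ne_eq, Circle.coe_inj]
    exact fun h => hi (AddCircle.injective_toCircle (Fact.out : 0 < L).ne' h)
  rw [← hspan]
  exact congr_arg (Subalgebra.toSubmodule <| StarSubalgebra.toSubalgebra ·)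
    (ContinuousMap.starSubalgebra_topologicalClosure_eq_top_of_separatesPoints A hsep)

end Characters

section Completeness

variable {d : ℕ} {L : ℝ} [Fact (0 < L)]

lemma inner_toL2_eq_integral (f : C(Torus d L, ℝ)) (v : L2 d L) :
    inner ℝ (toL2 f) v = ∫ x, v x * f x := by
  rw [inner_eq_integral]
  refine integral_congr_ae ?_
  filter_upwards [coeFn_toL2 f] with x hx
  rw [hx, mul_comm]

/-- The modes `ω_l` span a dense subspace of the even functions. -/
lemma eq_zero_of_inner_omega {v : L2 d L} (hv : v ∈ L2S d L)
    (h : ∀ l : Fin d → ℕ, inner ℝ (toL2 (omega l)) v = 0) : v = 0 := by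
  -- Pairing with v. An even v sees only the even parts of the factors of a character, that is a
  -- product of cosines, so Λ kills all characters and, by density, every continuous function.
  let Λ : C(Torus d L, ℂ) →L[ℂ] ℂ :=
    LinearMap.mkContinuous
      { toFun := fun g => ∫ x, v x • g x
        map_add' := fun g g' => by
          simp only [ContinuousMap.add_apply, smul_add]
          have hi : ∀ g : C(Torus d L, ℂ), Integrable fun x => v x • g x := fun g =>
            (integrable_coeFn v).smul_bdd ‖g‖ g.continuous.aestronglyMeasurable
              (Eventually.of_forall fun x => g.norm_coe_le_norm x)
          exact integral_add (hi g) (hi g')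
        map_smul' := fun c g => by
          simp only [ContinuousMap.smul_apply, RingHom.id_apply]
          rw [← integral_smul]
          simp only [smul_comm c] }
      (∫ x, ‖v x‖) fun g => by
        refine (norm_integral_le_integral_norm _).trans ?_
        rw [← integral_mul_const]
        refine integral_mono_of_nonneg (Eventually.of_forall fun x => norm_nonneg _)
          ((integrable_coeFn v).norm.mul_const _) (Eventually.of_forall fun x => ?_)
        simp only [norm_smul]
        gcongr
        exact g.norm_coe_le_norm x
  have hΛ : ∀ g, Λ g = ∫ x, v x • g x := fun g => rfl
  have hchar : ∀ n, Λ (torusChar L n) = 0 := by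
    intro n
    have h1 := integral_smul_prod_evenPart hv fun i => (fourier (n i) : C(AddCircle L, ℂ))
    simp only [evenPart_fourier] at h1
    rw [hΛ]
    change ∫ x, v x • ∏ i, fourier (n i) (x i) = 0
    rw [← h1]
    have h2 := h fun i => (n i).natAbs
    rw [inner_toL2_eq_integral] at h2
    have h3 : ∫ x, v x * ∏ i, cosMode ((n i).natAbs) (x i) = 0 := by
      have hne : Theta (fun i => (n i).natAbs) / L ^ ((d : ℝ) / 2) ≠ 0 :=
        (div_pos (Theta_pos _) rpow_half_pos).ne'
      refine (mul_eq_zero.1 (?_ : Theta (fun i => (n i).natAbs) / L ^ ((d : ℝ) / 2) * _ = 0)).resolve_left hne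
      rw [← h2, ← integral_const_mul]
      refine integral_congr_ae (Eventually.of_forall fun x => ?_)
      simp only [omega_apply]
      ring
    have h4 : ∀ x : Torus d L, v x • ∏ i, ((cosMode ((n i).natAbs) (x i) : ℝ) : ℂ) =
        ((v x * ∏ i, cosMode ((n i).natAbs) (x i) : ℝ) : ℂ) := by
      intro x
      rw [Complex.real_smul]
      push_cast
      rfl
    simp_rw [h4]
    rw [integral_complex_ofReal, h3, Complex.ofReal_zero]
  have hΛ0 : ∀ g, Λ g = 0 := by
    have hle : Submodule.span ℂ (range (torusChar (d := d) L)) ≤ Λ.ker := by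
      rw [Submodule.span_le]
      rintro _ ⟨n, rfl⟩
      exact hchar n
    have := Submodule.topologicalClosure_minimal _ hle Λ.isClosed_ker
    rw [span_torusChar_closure_eq_top] at this
    exact fun g => this trivial
  have hreal : ∀ f : C(Torus d L, ℝ), inner ℝ (toL2 f) v = 0 := by
    intro f
    have h1 := hΛ0 ⟨fun x => (f x : ℂ), by fun_prop⟩
    rw [hΛ] at h1
    have h4 : ∀ x : Torus d L, v x • ((f x : ℝ) : ℂ) = ((v x * f x : ℝ) : ℂ) := by
      intro x
      rw [Complex.real_smul]
      push_cast
      rfl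
    simp only [ContinuousMap.coe_mk, h4] at h1
    rw [integral_complex_ofReal, Complex.ofReal_eq_zero] at h1
    rw [inner_toL2_eq_integral, h1]
  have hdense : DenseRange (toL2 : C(Torus d L, ℝ) → L2 d L) :=
    ContinuousMap.toLp_denseRange ℝ volume ℝ (by simp)
  refine hdense.eq_zero_of_inner_right ℝ ?_
  exact hreal

/-! ### The bifurcating modes -/

lemma omega_zero_pos (k : Fin d → ℕ) : 0 < (omega k : C(Torus d L, ℝ)) 0 := by
  rw [omega_apply]
  simp only [Pi.zero_apply, cosMode_zero_right, Finset.prod_const_one, mul_one]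
  exact div_pos (Theta_pos k) rpow_half_pos

lemma toL2_ne_zero {f : C(Torus d L, ℝ)} (x : Torus d L) (hf : f x ≠ 0) : toL2 f ≠ 0 := by
  intro h
  refine hf ?_
  have : f = 0 := ContinuousMap.toLp_injective (𝕜 := ℝ) (p := 2) volume
    (h.trans (map_zero _).symm)
  rw [this]; rfl

lemma integral_omega {k : Fin d → ℕ} (hk : k ≠ 0) : ∫ x : Torus d L, omega k x = 0 := by
  obtain ⟨a, ha⟩ := Function.ne_iff.1 hk
  have ha' : (k a : ℤ) ≠ 0 := by exact_mod_cast ha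
  -- Half a period of the cosine in a coordinate with nonzero frequency: this translation changes
  -- the sign of ω_k but not its integral.
  let y : Torus d L := Pi.single a ((L / 2 / (k a : ℤ) : ℝ) : AddCircle L)
  have h : ∀ x, omega k (x + y) = -omega k x := by
    intro x
    rw [omega_apply, omega_apply, ← Finset.mul_prod_erase _ _ (Finset.mem_univ a),
      ← Finset.mul_prod_erase _ _ (Finset.mem_univ a)]
    have h1 : cosMode (k a) ((x + y) a) = -cosMode (k a) (x a) := by
      simp only [cosMode, ContinuousMap.coe_mk, Pi.add_apply, y, Pi.single_eq_same]
      rw [fourier_add_half_inv_index ha' Fact.out, Complex.neg_re]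
    have h2 : ∏ i ∈ Finset.univ.erase a, cosMode (k i) ((x + y) i) =
        ∏ i ∈ Finset.univ.erase a, cosMode (k i) (x i) :=
      Finset.prod_congr rfl fun i hi => by
        simp [y, Finset.ne_of_mem_erase hi]
    rw [h1, h2]
    ring
  have h1 := integral_add_right_eq_self (μ := volume) (fun x : Torus d L => omega k x) y
  simp only [h, integral_neg] at h1
  linarith

lemma inner_toL2_const (f : C(Torus d L, ℝ)) (c : ℝ) :
    inner ℝ (toL2 f) (constL2 c : L2 d L) = c * ∫ x, f x := by
  rw [inner_toL2_eq_integral, ← integral_const_mul]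
  refine integral_congr_ae ?_
  filter_upwards [Lp.coeFn_const (p := 2) (volume : Measure (Torus d L)) c] with x hx
  rw [constL2, hx]
  rfl

lemma toL2_omega_mem (k : Fin d → ℕ) :
    toL2 (omega k) ∈ fixedSpace (range (flipSymm : Fin d → TorusSymm d L)) := by
  refine toL2_mem_fixedSpace ?_
  rintro _ ⟨i, rfl⟩ x
  rw [omega_apply, omega_apply]
  congr 1
  refine Finset.prod_congr rfl fun j _ => ?_
  by_cases hj : j = i
  · subst hj; simp [flipSymm, cosMode_neg]
  · simp [flipSymm, hj]

lemma inner_omega_comp_perm {v : L2 d L} (hv : v ∈ L2ex d L) (k : Fin d → ℕ)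
    (ζ : Equiv.Perm (Fin d)) :
    inner ℝ (toL2 (omega (k ∘ ζ))) v = inner ℝ (toL2 (omega k)) v := by
  rw [inner_toL2_eq_integral, inner_toL2_eq_integral, ← (permSymm ζ).integral_comp]
  refine integral_congr_ae ?_
  filter_upwards [hv.2 ζ] with x hx
  change v (x ∘ ζ) * omega (k ∘ ζ) (x ∘ ζ) = _
  rw [hx, omega_comp_perm]

lemma modeRatio_comp_perm {W : L2 d L} (hW : W ∈ L2ex d L) (k : Fin d → ℕ)
    (ζ : Equiv.Perm (Fin d)) : modeRatio W (k ∘ ζ) = modeRatio W k := by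
  have h1 : Theta (k ∘ ζ) = Theta k :=
    Equiv.prod_comp ζ fun i => √(2 - if k i = 0 then (1 : ℝ) else 0)
  have h2 := inner_omega_comp_perm hW k ζ
  rw [inner_toL2_eq_integral, inner_toL2_eq_integral] at h2
  rw [modeRatio, modeRatio, h1, fourierMode, fourierMode, h2]

lemma sqrt_card_permClass_pos (k : Fin d → ℕ) : 0 < √((permClass k).card : ℝ) :=
  Real.sqrt_pos.2 (by exact_mod_cast Finset.card_pos.2 ⟨k, self_mem_permClass k⟩)

lemma toL2_omegaEx (k : Fin d → ℕ) : (toL2 (omegaEx k) : L2 d L) =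
    (1 / √((permClass k).card : ℝ)) • ∑ l ∈ permClass k, toL2 (omega l) := by
  simp only [toL2, omegaEx, map_smul, map_sum]

lemma omegaEx_zero_pos (k : Fin d → ℕ) : 0 < (omegaEx k : C(Torus d L, ℝ)) 0 := by
  rw [omegaEx_apply]
  exact mul_pos (one_div_pos.2 (sqrt_card_permClass_pos k))
    (Finset.sum_pos (fun l _ => omega_zero_pos l) ⟨k, self_mem_permClass k⟩)

lemma integral_omegaEx {k : Fin d → ℕ} (hk : k ≠ 0) : ∫ x : Torus d L, omegaEx k x = 0 := by
  simp_rw [omegaEx_apply]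
  rw [integral_const_mul, integral_finsetSum]
  · rw [Finset.sum_eq_zero, mul_zero]
    intro l hl
    obtain ⟨ζ, rfl⟩ := mem_permClass.1 hl
    refine integral_omega fun h0 => hk ?_
    funext i
    have := congrFun h0 (ζ.symm i)
    simpa using this
  · intro l _
    exact ((omega l : C(Torus d L, ℝ)).continuous.integrable_of_hasCompactSupport
      (HasCompactSupport.of_compactSpace _))

lemma toL2_omegaEx_mem (k : Fin d → ℕ) : toL2 (omegaEx k) ∈
    fixedSpace (range flipSymm ∪ range permSymm : Set (TorusSymm d L)) := by
  have h : toL2 (omegaEx k) ∈ fixedSpace (range (flipSymm : Fin d → TorusSymm d L)) := by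
    rw [toL2_omegaEx]
    exact Submodule.smul_mem _ _ (Submodule.sum_mem _ fun l _ => toL2_omega_mem l)
  have h2 : toL2 (omegaEx k) ∈ fixedSpace (range (permSymm : _ → TorusSymm d L)) := by
    refine toL2_mem_fixedSpace ?_
    rintro _ ⟨ζ, rfl⟩ x
    exact omegaEx_comp_perm k ζ x
  rw [mem_fixedSpace] at h h2 ⊢
  rintro σ (hσ | hσ)
  exacts [h σ hσ, h2 σ hσ]

lemma modeRatio_eq_of_mem_permClass {W : L2 d L} (hW : W ∈ L2ex d L) {k l : Fin d → ℕ}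
    (hl : l ∈ permClass k) : modeRatio W l = modeRatio W k := by
  obtain ⟨ζ, rfl⟩ := mem_permClass.1 hl
  exact modeRatio_comp_perm hW k ζ

lemma convOp_omegaEx {W : L2 d L} (hW : W ∈ L2ex d L) (k : Fin d → ℕ) :
    convOp W (toL2 (omegaEx k)) = (L ^ ((d : ℝ) / 2) * modeRatio W k) • omegaEx k := by
  rw [toL2_omegaEx, map_smul, map_sum, Finset.sum_congr rfl fun l hl => by
    rw [convOp_omega hW.1, modeRatio_eq_of_mem_permClass hW hl], ← Finset.smul_sum, smul_comm]
  rfl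

lemma inner_toL2_convOp_omegaEx {W : L2 d L} (hW : W ∈ L2ex d L) (v : L2 d L) (k : Fin d → ℕ) :
    inner ℝ (toL2 (omegaEx k)) (toL2 (convOp W v)) =
      L ^ ((d : ℝ) / 2) * modeRatio W k * inner ℝ (toL2 (omegaEx k)) v := by
  rw [toL2_omegaEx, inner_smul_left, inner_smul_left, sum_inner, sum_inner, Finset.sum_congr rfl
    fun l hl => by rw [inner_toL2_convOp_omega hW.1, modeRatio_eq_of_mem_permClass hW hl],
    ← Finset.mul_sum]
  ring

/-- An exchangeable function orthogonal to `ω_[k]` is orthogonal to all `ω_l`, `l ∈ [k]`. -/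
lemma inner_omega_eq_zero_of_inner_omegaEx {v : L2 d L} (hv : v ∈ L2ex d L) {k l : Fin d → ℕ}
    (hl : l ∈ permClass k) (h : inner ℝ (toL2 (omegaEx k)) v = 0) :
    inner ℝ (toL2 (omega l)) v = 0 := by
  have h1 : ∀ m ∈ permClass k, inner ℝ (toL2 (omega m)) v = inner ℝ (toL2 (omega k)) v := by
    intro m hm
    obtain ⟨ζ, rfl⟩ := mem_permClass.1 hm
    exact inner_omega_comp_perm hv k ζ
  rw [toL2_omegaEx, inner_smul_left, sum_inner, Finset.sum_congr rfl h1, Finset.sum_const] at h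
  rw [h1 l hl]
  have h2 := (sqrt_card_permClass_pos k).ne'
  have h3 : (permClass k).card ≠ 0 := Finset.card_ne_zero_of_mem hl
  simpa [h2, h3] using h

end Completeness

/-! ### The response function -/

/-- The standing assumptions on the activation function. -/
structure IsActivation (Φ : ℝ → ℝ) : Prop where
  contDiff : ContDiff ℝ 2 Φ
  convex : ∀ x, 0 ≤ iteratedDeriv 2 Φ x
  strictMonoOn : StrictMonoOn Φ (Ici 0)
  eq_zero : ∀ x ≤ 0, Φ x = 0

namespace IsActivation

variable {Φ : ℝ → ℝ}

lemma differentiable (hΦ : IsActivation Φ) : Differentiable ℝ Φ := hΦ.contDiff.differentiable two_ne_zero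

lemma pos (hΦ : IsActivation Φ) {x : ℝ} (hx : 0 < x) : 0 < Φ x :=
  hΦ.eq_zero 0 le_rfl ▸ hΦ.strictMonoOn self_mem_Ici hx.le hx

lemma nonneg (hΦ : IsActivation Φ) (x : ℝ) : 0 ≤ Φ x :=
  (le_or_gt x 0).elim (fun h => (hΦ.eq_zero x h).ge) fun h => (hΦ.pos h).le

lemma monotone (hΦ : IsActivation Φ) : Monotone Φ := by
  intro x y hxy
  rcases le_or_gt x 0 with hx | hx
  · rw [hΦ.eq_zero x hx]; exact hΦ.nonneg y
  · exact hΦ.strictMonoOn.monotoneOn hx.le (hx.le.trans hxy) hxy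

lemma contDiff_deriv (hΦ : IsActivation Φ) : ContDiff ℝ 1 (deriv Φ) := by
  have h := hΦ.contDiff
  rw [show (2 : WithTop ℕ∞) = 1 + 1 by norm_num, contDiff_succ_iff_deriv] at h
  exact h.2.2

lemma continuous_deriv (hΦ : IsActivation Φ) : Continuous (deriv Φ) := hΦ.contDiff_deriv.continuous

lemma monotone_deriv (hΦ : IsActivation Φ) : Monotone (deriv Φ) := by
  refine monotone_of_deriv_nonneg (hΦ.contDiff_deriv.differentiable one_ne_zero) fun x => ?_
  have := hΦ.convex x
  rwa [iteratedDeriv_succ, iteratedDeriv_one] at this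

/-- Every such point is a minimum of the nonnegative function Φ. -/
lemma deriv_eq_zero (hΦ : IsActivation Φ) {x : ℝ} (hx : x ≤ 0) : deriv Φ x = 0 := by
  refine IsLocalMin.deriv_eq_zero (Eventually.of_forall fun y => ?_)
  rw [hΦ.eq_zero x hx]
  exact hΦ.nonneg y

lemma deriv_nonneg (hΦ : IsActivation Φ) (x : ℝ) : 0 ≤ deriv Φ x := hΦ.monotone.deriv_nonneg

/-- If Φ'(x) ≤ 0, convexity gives Φ' ≤ 0 on [0, x], hence Φ(x) ≤ Φ(0) = 0, against strict
monotonicity. -/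
lemma deriv_pos (hΦ : IsActivation Φ) {x : ℝ} (hx : 0 < x) : 0 < deriv Φ x := by
  by_contra h
  have hle : ∀ y ∈ interior (Icc 0 x), deriv Φ y ≤ 0 := fun y hy =>
    (hΦ.monotone_deriv (interior_subset hy).2).trans (not_lt.1 h)
  have := antitoneOn_of_deriv_nonpos (convex_Icc 0 x) hΦ.differentiable.continuous.continuousOn
    hΦ.differentiable.differentiableOn hle (left_mem_Icc.2 hx.le) (right_mem_Icc.2 hx.le) hx.le
  exact absurd (hΦ.pos hx) (not_lt.2 (this.trans_eq (hΦ.eq_zero 0 le_rfl)))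

lemma pos_of_deriv_pos (hΦ : IsActivation Φ) {x : ℝ} (h : 0 < deriv Φ x) : 0 < x := by
  by_contra hx
  exact h.ne' (hΦ.deriv_eq_zero (not_lt.1 hx))

end IsActivation

/-- The local response `w ↦ gaussMean κ (Φ (w + B))` at noise strength `1/κ = exp(-τ)`. -/
def response (d : ℕ) (L : ℝ) (Φ : ℝ → ℝ) (B τ w : ℝ) : ℝ :=
  gaussMean d L (Real.exp τ) (Φ (w + B))

/-- The derivative of the local response in `w`. -/
def responseDeriv (d : ℕ) (L : ℝ) (Φ : ℝ → ℝ) (B τ w : ℝ) : ℝ :=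
  truncVar (Real.exp (τ / 2) * Φ (w + B)) * deriv Φ (w + B) / L ^ d

lemma sqrt_exp (τ : ℝ) : √(Real.exp τ) = Real.exp (τ / 2) := (Real.exp_half τ).symm

section Response

variable {d : ℕ} {L : ℝ} {Φ : ℝ → ℝ} {B : ℝ}

lemma response_eq (hΦ : IsActivation Φ) (τ w : ℝ) : response d L Φ B τ w =
    (Φ (w + B) + mills (Real.exp (τ / 2) * Φ (w + B)) / Real.exp (τ / 2)) / L ^ d := by
  rw [response, gaussMean_eq d L (Real.exp_pos τ) (hΦ.nonneg _), sqrt_exp]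

/-- This form, through t + `mills t`, shows the dependence on the input w; `response_eq` shows the
dependence on the noise. -/
lemma response_eq' (hΦ : IsActivation Φ) (τ w : ℝ) : response d L Φ B τ w =
    (Real.exp (τ / 2) * Φ (w + B) + mills (Real.exp (τ / 2) * Φ (w + B))) /
      Real.exp (τ / 2) / L ^ d := by
  rw [response_eq hΦ, add_div (_ * _), mul_div_cancel_left₀ _ (Real.exp_pos _).ne']

lemma exp_mul_nonneg (hΦ : IsActivation Φ) (τ w : ℝ) : 0 ≤ Real.exp (τ / 2) * Φ w :=
  mul_nonneg (Real.exp_pos _).le (hΦ.nonneg _)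

lemma contDiff_response (hΦ : IsActivation Φ) :
    ContDiff ℝ 2 fun p : ℝ × ℝ => response d L Φ B p.1 p.2 := by
  have hφ : ContDiff ℝ 2 fun p : ℝ × ℝ => Φ (p.2 + B) := hΦ.contDiff.comp (by fun_prop)
  have he : ContDiff ℝ 2 fun p : ℝ × ℝ => Real.exp (p.1 / 2) := by fun_prop
  have ht := he.mul hφ
  have hm : ContDiff ℝ 2 fun p : ℝ × ℝ => mills (Real.exp (p.1 / 2) * Φ (p.2 + B)) := by
    unfold mills
    refine ContDiff.div (Real.contDiff_exp.comp ((ht.pow 2).div_const 2).neg)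
      ((contDiff_gaussInt (n := 2)).comp ht) fun p => ?_
    exact (gaussInt_pos (exp_mul_nonneg hΦ _ _)).ne'
  simp_rw [response_eq hΦ]
  exact (hφ.add (hm.div he fun p => (Real.exp_pos _).ne')).div_const _

lemma continuous_response (hΦ : IsActivation Φ) :
    Continuous fun p : ℝ × ℝ => response d L Φ B p.1 p.2 := (contDiff_response hΦ).continuous

lemma hasDerivAt_response (hΦ : IsActivation Φ) (τ w : ℝ) :
    HasDerivAt (response d L Φ B τ) (responseDeriv d L Φ B τ w) w := by
  have h1 : HasDerivAt (fun w => Real.exp (τ / 2) * Φ (w + B))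
      (Real.exp (τ / 2) * deriv Φ (w + B)) w :=
    ((hΦ.differentiable (w + B)).hasDerivAt.comp_add_const w B).const_mul _
  have h2 := (((hasDerivAt_id_add_mills (exp_mul_nonneg hΦ τ (w + B))).comp w h1).div_const
    (Real.exp (τ / 2))).div_const (L ^ d)
  rw [show response d L Φ B τ = _ from funext fun w => response_eq' hΦ τ w]
  refine h2.congr_deriv ?_
  rw [responseDeriv]
  field_simp

variable [Fact (0 < L)]

lemma pow_pos_of_fact : 0 < L ^ d := pow_pos Fact.out d

lemma responseDeriv_nonneg (hΦ : IsActivation Φ) (τ w : ℝ) : 0 ≤ responseDeriv d L Φ B τ w :=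
  div_nonneg (mul_nonneg (truncVar_pos (exp_mul_nonneg hΦ _ _)).le (hΦ.deriv_nonneg _))
    pow_pos_of_fact.le

lemma monotone_response (hΦ : IsActivation Φ) (τ : ℝ) : Monotone (response d L Φ B τ) :=
  monotone_of_hasDerivAt_nonneg (hasDerivAt_response hΦ τ) fun w => responseDeriv_nonneg hΦ τ w

lemma antitone_response (hΦ : IsActivation Φ) (w : ℝ) :
    Antitone fun τ => response d L Φ B τ w := by
  intro τ τ' h
  have hL : 0 < L ^ d := pow_pos_of_fact
  simp only [response_eq hΦ]
  have h1 : Real.exp (τ / 2) ≤ Real.exp (τ' / 2) := Real.exp_le_exp.2 (by linarith)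
  have h2 : mills (Real.exp (τ' / 2) * Φ (w + B)) ≤ mills (Real.exp (τ / 2) * Φ (w + B)) :=
    antitoneOn_mills (exp_mul_nonneg hΦ _ _) (exp_mul_nonneg hΦ _ _)
      (mul_le_mul_of_nonneg_right h1 (hΦ.nonneg _))
  have h3 := (mills_pos (exp_mul_nonneg hΦ τ (w + B))).le
  gcongr

lemma le_response (hΦ : IsActivation Φ) (τ w : ℝ) :
    √(2 / Real.pi) / Real.exp (τ / 2) / L ^ d ≤ response d L Φ B τ w := by
  have hL : 0 < L ^ d := pow_pos_of_fact
  rw [response_eq' hΦ, ← mills_zero]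
  have := strictMonoOn_id_add_mills.monotoneOn self_mem_Ici (exp_mul_nonneg hΦ τ (w + B))
    (exp_mul_nonneg hΦ τ (w + B))
  simp only [zero_add] at this
  gcongr

lemma response_pos (hΦ : IsActivation Φ) (τ w : ℝ) : 0 < response d L Φ B τ w := by
  have hL : 0 < L ^ d := pow_pos_of_fact
  exact (by positivity : (0 : ℝ) < √(2 / Real.pi) / Real.exp (τ / 2) / L ^ d).trans_le
    (le_response hΦ τ w)

/-! ### The homogeneous branch -/

lemma strictMono_sub_response (hΦ : IsActivation Φ) {a : ℝ} (ha : a < 0) (τ : ℝ) :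
    StrictMono fun r => r - response d L Φ B τ (a * r) := by
  intro r r' h
  have := monotone_response (d := d) (L := L) (B := B) hΦ τ
    (mul_le_mul_of_nonpos_left h.le ha.le)
  simp only
  linarith

lemma existsUnique_eq_response (hΦ : IsActivation Φ) {a : ℝ} (ha : a < 0) (τ : ℝ) :
    ∃! r, r = response d L Φ B τ (a * r) := by
  have hmono := strictMono_sub_response (d := d) (L := L) (B := B) hΦ ha τ
  have hcont : Continuous fun r => r - response d L Φ B τ (a * r) := by
    have h : Continuous fun r : ℝ => response d L Φ B τ (a * r) :=
      (continuous_response hΦ).comp (f := fun r : ℝ => (τ, a * r)) (by fun_prop)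
    fun_prop
  have h0 : (0 : ℝ) - response d L Φ B τ (a * 0) ≤ 0 := by
    have := response_pos (d := d) (L := L) (B := B) hΦ τ (a * 0)
    linarith
  have h1 : 0 ≤ response d L Φ B τ 0 - response d L Φ B τ (a * response d L Φ B τ 0) := by
    refine sub_nonneg.2 (monotone_response hΦ τ ?_)
    exact mul_nonpos_of_nonpos_of_nonneg ha.le (response_pos hΦ τ 0).le
  obtain ⟨r, hr⟩ := mem_range_of_exists_le_of_exists_ge hcont ⟨_, h0⟩ ⟨_, h1⟩
  refine ⟨r, sub_eq_zero.1 hr, fun r' hr' => hmono.injective ?_⟩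
  exact (sub_eq_zero.2 hr').trans hr.symm

variable {W : L2 d L}

lemma isHomogeneousMean_exp_iff {τ r : ℝ} : IsHomogeneousMean Φ B W (Real.exp τ) r ↔
    r = response d L Φ B τ (meanW W * r) := isHomogeneousMean_iff Φ B W (Real.exp_pos τ) r

lemma existsUnique_isHomogeneousMean (hΦ : IsActivation Φ) (hW : meanW W < 0) {κ : ℝ}
    (hκ : 0 < κ) : ∃! r, IsHomogeneousMean Φ B W κ r := by
  rw [← Real.exp_log hκ]
  simp only [isHomogeneousMean_exp_iff]
  exact existsUnique_eq_response hΦ hW _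

lemma rhoInf_eq (hΦ : IsActivation Φ) (hW : meanW W < 0) (τ : ℝ) :
    rhoInf Φ B W (Real.exp τ) =
      response d L Φ B τ (meanW W * rhoInf Φ B W (Real.exp τ)) := by
  rw [← isHomogeneousMean_exp_iff]
  exact Classical.epsilon_spec (existsUnique_isHomogeneousMean hΦ hW (Real.exp_pos τ)).exists

/-- A comparison principle: r minus the response at W₀ r is strictly increasing and vanishes at the
root. Questions about the root in τ become questions about the response at a fixed r. -/
lemma rhoInf_le_iff (hΦ : IsActivation Φ) (hW : meanW W < 0) {τ r : ℝ} :
    rhoInf Φ B W (Real.exp τ) ≤ r ↔ response d L Φ B τ (meanW W * r) ≤ r := by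
  rw [← (strictMono_sub_response (d := d) (L := L) (B := B) hΦ hW τ).le_iff_le]
  rw [← rhoInf_eq hΦ hW τ, sub_self, sub_nonneg]

lemma antitone_rhoInf_exp (hΦ : IsActivation Φ) (hW : meanW W < 0) :
    Antitone fun τ => rhoInf Φ B W (Real.exp τ) := by
  intro τ τ' h
  simp only
  rw [rhoInf_le_iff hΦ hW]
  exact (antitone_response hΦ _ h).trans_eq (rhoInf_eq hΦ hW τ).symm

lemma rhoInf_pos (hΦ : IsActivation Φ) (hW : meanW W < 0) (τ : ℝ) :
    0 < rhoInf Φ B W (Real.exp τ) := by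
  rw [rhoInf_eq hΦ hW τ]
  exact response_pos hΦ _ _

lemma continuous_rhoInf_exp (hΦ : IsActivation Φ) (hW : meanW W < 0) :
    Continuous fun τ => rhoInf Φ B W (Real.exp τ) := by
  have hc : ∀ r : ℝ, Continuous fun τ => response d L Φ B τ (meanW W * r) := fun r =>
    (continuous_response hΦ).comp (f := fun τ : ℝ => (τ, meanW W * r)) (by fun_prop)
  refine continuous_iff_continuousAt.2 fun τ₀ => tendsto_order.2 ⟨fun r hr => ?_, fun r hr => ?_⟩
  · rw [← not_le, rhoInf_le_iff hΦ hW, not_le] at hr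
    filter_upwards [(hc r).continuousAt.eventually (lt_mem_nhds hr)] with τ hτ
    rwa [← not_le, rhoInf_le_iff hΦ hW, not_le]
  -- The comparison principle bounds the root by s only with ≤, so s is taken strictly below r.
  · obtain ⟨s, hs1, hs2⟩ := exists_between hr
    have h1 : response d L Φ B τ₀ (meanW W * s) < s := by
      have := strictMono_sub_response (d := d) (L := L) (B := B) hΦ hW τ₀ hs1
      simp only at this
      rw [← rhoInf_eq hΦ hW τ₀, sub_self] at this
      linarith
    filter_upwards [(hc s).continuousAt.eventually (gt_mem_nhds h1)] with τ hτ
    exact ((rhoInf_le_iff hΦ hW).2 hτ.le).trans_lt hs2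

/-! ### The slope along the homogeneous branch -/

/-- The derivative of the response along the homogeneous branch. -/
def branchSlope (Φ : ℝ → ℝ) (B : ℝ) (W : L2 d L) (τ : ℝ) : ℝ :=
  responseDeriv d L Φ B τ (meanW W * rhoInf Φ B W (Real.exp τ))

/-- Let b = √κ and m = `mills (b * Φ₀)`. The fixed point equation gives r - Φ₀/L^d = m/(b L^d), and
the bracket in (∗) becomes (1 - m(bΦ₀ + m))/L^d, the truncated variance over L^d. -/
lemma bifurcationCondition_iff (hΦ : IsActivation Φ) (hW : meanW W < 0) (k : Fin d → ℕ) (τ : ℝ) :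
    BifurcationCondition Φ B W k (Real.exp τ) ↔ branchSlope Φ B W τ ≠ 0 ∧
      L ^ ((d : ℝ) / 2) * modeRatio W k * branchSlope Φ B W τ = 1 := by
  have hL : 0 < L ^ d := pow_pos_of_fact
  have hL2 : 0 < L ^ ((d : ℝ) / 2) := Real.rpow_pos_of_pos Fact.out _
  set r := rhoInf Φ B W (Real.exp τ) with hr
  set φ := Φ (meanW W * r + B) with hφ
  have hD : L ^ ((d : ℝ) / 2) * deriv Φ (meanW W * r + B) *
      (1 / L ^ d - L ^ d * r * (r - φ / L ^ d) * Real.exp τ) =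
      L ^ ((d : ℝ) / 2) * branchSlope Φ B W τ := by
    have h1 := rhoInf_eq (B := B) hΦ hW τ
    rw [response_eq hΦ, ← hr, ← hφ] at h1
    rw [branchSlope, responseDeriv, ← hr, ← hφ, truncVar]
    have h2 : Real.exp τ = Real.exp (τ / 2) * Real.exp (τ / 2) := by
      rw [← Real.exp_add, add_halves]
    have h3 := Real.exp_pos (τ / 2)
    rw [h2]
    generalize mills (Real.exp (τ / 2) * φ) = m at *
    generalize Real.exp (τ / 2) = b at *
    rw [h1]
    field_simp
    ring
  have hcond : BifurcationCondition Φ B W k (Real.exp τ) ↔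
      L ^ ((d : ℝ) / 2) * branchSlope Φ B W τ ≠ 0 ∧
        modeRatio W k = 1 / (L ^ ((d : ℝ) / 2) * branchSlope Φ B W τ) := by
    rw [← hD]
    rfl
  rw [hcond, mul_ne_zero_iff, and_iff_right hL2.ne']
  refine and_congr_right fun hs => ?_
  rw [eq_div_iff (mul_ne_zero hL2.ne' hs)]
  constructor <;> intro h <;> linarith

lemma branchSlope_nonneg (hΦ : IsActivation Φ) (τ : ℝ) : 0 ≤ branchSlope Φ B W τ :=
  responseDeriv_nonneg hΦ _ _

lemma monotone_branch_arg (hΦ : IsActivation Φ) (hW : meanW W < 0) :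
    Monotone fun τ => meanW W * rhoInf Φ B W (Real.exp τ) + B := fun _ _ h =>
  add_le_add_left (mul_le_mul_of_nonpos_left (antitone_rhoInf_exp hΦ hW h) hW.le) B

lemma branch_arg_pos (hΦ : IsActivation Φ) {τ : ℝ} (h : 0 < branchSlope Φ B W τ) :
    0 < meanW W * rhoInf Φ B W (Real.exp τ) + B := by
  refine hΦ.pos_of_deriv_pos ((hΦ.deriv_nonneg _).lt_of_ne' fun h0 => ?_)
  rw [branchSlope, responseDeriv, h0] at h
  simp at h

/-- A lower bound on the slope, with the argument of the activation function frozen. -/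
lemma frozen_le_branchSlope (hΦ : IsActivation Φ) (hW : meanW W < 0) {τ τ' : ℝ} (h : τ ≤ τ') :
    truncVar (Real.exp (τ' / 2) * Φ (meanW W * rhoInf Φ B W (Real.exp τ) + B)) *
      deriv Φ (meanW W * rhoInf Φ B W (Real.exp τ) + B) / L ^ d ≤ branchSlope Φ B W τ' := by
  have hL : 0 < L ^ d := pow_pos_of_fact
  have h1 := monotone_branch_arg (B := B) hΦ hW h
  simp only at h1
  rw [branchSlope, responseDeriv]
  have h2 := strictMonoOn_truncVar.monotoneOn (exp_mul_nonneg hΦ τ' _) (exp_mul_nonneg hΦ τ' _)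
    (mul_le_mul_of_nonneg_left (hΦ.monotone h1) (Real.exp_pos (τ' / 2)).le)
  have h3 := hΦ.monotone_deriv h1
  have h4 := hΦ.deriv_nonneg (meanW W * rhoInf Φ B W (Real.exp τ) + B)
  have h5 := (truncVar_pos (exp_mul_nonneg hΦ τ' (meanW W * rhoInf Φ B W (Real.exp τ') + B))).le
  gcongr

/-- Strictness comes from the explicit factor √κ in the argument of `truncVar`: a positive slope
forces Φ₀ and Φ₀' to be positive. -/
lemma branchSlope_lt (hΦ : IsActivation Φ) (hW : meanW W < 0) {τ τ' : ℝ} (h : τ < τ')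
    (hpos : 0 < branchSlope Φ B W τ) : branchSlope Φ B W τ < branchSlope Φ B W τ' := by
  have hL : 0 < L ^ d := pow_pos_of_fact
  have harg := branch_arg_pos hΦ hpos
  refine lt_of_lt_of_le ?_ (frozen_le_branchSlope hΦ hW h.le)
  rw [branchSlope, responseDeriv]
  refine div_lt_div_of_pos_right (mul_lt_mul_of_pos_right ?_ (hΦ.deriv_pos harg)) hL
  refine strictMonoOn_truncVar (exp_mul_nonneg hΦ τ _) (exp_mul_nonneg hΦ τ' _) ?_
  exact mul_lt_mul_of_pos_right (Real.exp_lt_exp.2 (by linarith)) (hΦ.pos harg)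

lemma monotone_branchSlope (hΦ : IsActivation Φ) (hW : meanW W < 0) :
    Monotone (branchSlope Φ B W) := by
  intro τ τ' h
  rcases h.eq_or_lt with rfl | h
  · exact le_rfl
  rcases (branchSlope_nonneg (B := B) (W := W) hΦ τ).eq_or_lt with h0 | h0
  · rw [← h0]; exact branchSlope_nonneg hΦ τ'
  · exact (branchSlope_lt hΦ hW h h0).le

lemma continuous_branchSlope (hΦ : IsActivation Φ) (hW : meanW W < 0) :
    Continuous (branchSlope Φ B W) := by
  have hc : Continuous fun τ => meanW W * rhoInf Φ B W (Real.exp τ) + B :=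
    ((continuous_rhoInf_exp hΦ hW).const_mul _).add continuous_const
  refine continuous_iff_continuousAt.2 fun τ => ?_
  have h1 : ContinuousAt (fun τ => Real.exp (τ / 2) * Φ (meanW W * rhoInf Φ B W (Real.exp τ) + B))
      τ := by
    have := hΦ.differentiable.continuous
    exact ((by fun_prop : Continuous fun τ : ℝ => Real.exp (τ / 2)).mul (this.comp hc)).continuousAt
  have h2 := ((hasDerivAt_truncVar (exp_mul_nonneg hΦ τ _)).continuousAt).comp
    (f := fun τ => Real.exp (τ / 2) * Φ (meanW W * rhoInf Φ B W (Real.exp τ) + B)) h1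
  exact (h2.mul (hΦ.continuous_deriv.comp hc).continuousAt).div_const _

/-- A positive slope needs W₀ρ + B > 0, so ρ < B/|W₀|, whereas ρ ≥ √(2/π)/(√κ L^d) always. -/
lemma lt_exp_of_branchSlope_pos (hΦ : IsActivation Φ) (hW : meanW W < 0) (hB : 0 < B) {τ : ℝ}
    (h : 0 < branchSlope Φ B W τ) :
    2 * |meanW W| ^ 2 / (L ^ (2 * d) * Real.pi * B ^ 2) < Real.exp τ := by
  have hL : 0 < L ^ d := pow_pos_of_fact
  have h1 := branch_arg_pos hΦ h
  have h2 := le_response (d := d) (L := L) (B := B) hΦ τ (meanW W * rhoInf Φ B W (Real.exp τ))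
  rw [← rhoInf_eq hΦ hW τ] at h2
  have hb := Real.exp_pos (τ / 2)
  have h3 : Real.exp τ = Real.exp (τ / 2) * Real.exp (τ / 2) := by
    rw [← Real.exp_add, add_halves]
  have hs : √(2 / Real.pi) ^ 2 = 2 / Real.pi := Real.sq_sqrt (by positivity)
  have hs0 : 0 ≤ √(2 / Real.pi) := Real.sqrt_nonneg _
  rw [sq_abs, pow_mul', h3]
  generalize √(2 / Real.pi) = s at *
  generalize Real.exp (τ / 2) = b at *
  have h4 : s * -meanW W < B * (b * L ^ d) := by
    rw [div_div, div_le_iff₀ (by positivity)] at h2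
    nlinarith [mul_pos hb hL]
  have h5 : (s * -meanW W) ^ 2 < (B * (b * L ^ d)) ^ 2 :=
    pow_lt_pow_left₀ h4 (mul_nonneg hs0 (by linarith)) two_ne_zero
  rw [mul_pow, hs] at h5
  rw [div_lt_iff₀ (by positivity)]
  have hpi := Real.pi_pos
  rw [div_mul_eq_mul_div, div_lt_iff₀ hpi] at h5
  nlinarith

lemma exists_branchSlope_eq_zero (hΦ : IsActivation Φ) (hW : meanW W < 0) (hB : 0 < B) :
    ∃ τ, branchSlope Φ B W τ = 0 := by
  have hL : 0 < L := Fact.out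
  have hpos : 0 < 2 * |meanW W| ^ 2 / (L ^ (2 * d) * Real.pi * B ^ 2) := by
    have := abs_pos.2 hW.ne
    positivity
  refine ⟨Real.log (2 * |meanW W| ^ 2 / (L ^ (2 * d) * Real.pi * B ^ 2)), ?_⟩
  by_contra h
  have := lt_exp_of_branchSlope_pos hΦ hW hB ((branchSlope_nonneg hΦ _).lt_of_ne' h)
  rw [Real.exp_log hpos] at this
  exact lt_irrefl _ this

/-- The homogeneous branch has a limit as the noise vanishes. -/
lemma exists_tendsto_rhoInf_exp (hΦ : IsActivation Φ) (hW : meanW W < 0) (hB : 0 < B) :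
    ∃ r, Tendsto (fun τ => rhoInf Φ B W (Real.exp τ)) atTop (𝓝 r) ∧ 0 < meanW W * r + B ∧
      Tendsto (branchSlope Φ B W) atTop (𝓝 (deriv Φ (meanW W * r + B) / L ^ d)) := by
  have hL : 0 < L ^ d := pow_pos_of_fact
  have hbdd : BddBelow (range fun τ => rhoInf Φ B W (Real.exp τ)) :=
    ⟨0, by rintro _ ⟨τ, rfl⟩; exact (rhoInf_pos hΦ hW τ).le⟩
  have hlim := tendsto_atTop_ciInf (antitone_rhoInf_exp hΦ hW) hbdd
  set r := ⨅ τ, rhoInf Φ B W (Real.exp τ) with hr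
  have harg : Tendsto (fun τ => meanW W * rhoInf Φ B W (Real.exp τ) + B) atTop
      (𝓝 (meanW W * r + B)) := (hlim.const_mul _).add_const B
  have hφ := (hΦ.differentiable.continuous.tendsto (meanW W * r + B)).comp harg
  have hexp : Tendsto (fun τ : ℝ => Real.exp (τ / 2)) atTop atTop :=
    Real.tendsto_exp_atTop.comp (tendsto_id.atTop_div_const two_pos)
  have hm : Tendsto (fun τ => mills (Real.exp (τ / 2) * Φ (meanW W * rhoInf Φ B W (Real.exp τ) + B))
      / Real.exp (τ / 2)) atTop (𝓝 0) := by
    have h0 := hexp.inv_tendsto_atTop.const_mul (mills 0)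
    rw [mul_zero] at h0
    refine squeeze_zero (fun τ => div_nonneg (mills_pos (exp_mul_nonneg hΦ _ _)).le
      (Real.exp_pos _).le) (fun τ => ?_) h0
    rw [div_eq_mul_inv]
    refine mul_le_mul_of_nonneg_right ?_ (by positivity)
    exact antitoneOn_mills self_mem_Ici (exp_mul_nonneg hΦ _ _) (exp_mul_nonneg hΦ _ _)
  have heq : r = Φ (meanW W * r + B) / L ^ d := by
    have h1 := (hφ.add hm).div_const (L ^ d)
    rw [add_zero] at h1
    refine tendsto_nhds_unique hlim (h1.congr fun τ => ?_)
    exact ((rhoInf_eq hΦ hW τ).trans (response_eq hΦ _ _)).symm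
  -- Otherwise the limit equation gives r = 0, and then the argument is B > 0.
  have hpos : 0 < meanW W * r + B := by
    by_contra h
    rw [hΦ.eq_zero _ (not_lt.1 h), zero_div] at heq
    rw [heq, mul_zero, zero_add] at h
    exact h hB
  refine ⟨r, hlim, hpos, ?_⟩
  have ht : Tendsto (fun τ => Real.exp (τ / 2) * Φ (meanW W * rhoInf Φ B W (Real.exp τ) + B))
      atTop atTop := hexp.atTop_mul_pos (hΦ.pos hpos) hφ
  have h1 := ((tendsto_truncVar_atTop.comp ht).mul
    ((hΦ.continuous_deriv.tendsto _).comp harg)).div_const (L ^ d)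
  rw [one_mul] at h1
  exact h1

/-- The slope crosses each of its positive values with nonzero speed. -/
lemma hasDerivAt_branchSlope_pos (hΦ : IsActivation Φ) (hW : meanW W < 0) {τ₀ a : ℝ}
    (hpos : 0 < branchSlope Φ B W τ₀) (h : HasDerivAt (branchSlope Φ B W) a τ₀) : 0 < a := by
  have hL : 0 < L ^ d := pow_pos_of_fact
  have harg := branch_arg_pos hΦ hpos
  set φ := Φ (meanW W * rhoInf Φ B W (Real.exp τ₀) + B) with hφ
  set φ' := deriv Φ (meanW W * rhoInf Φ B W (Real.exp τ₀) + B) with hφ'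
  have hφ0 : 0 < φ := hΦ.pos harg
  have hφ'0 : 0 < φ' := hΦ.deriv_pos harg
  have h1 : HasDerivAt (fun τ => Real.exp (τ / 2) * φ) (Real.exp (τ₀ / 2) * (1 / 2) * φ) τ₀ :=
    (((hasDerivAt_id τ₀).div_const 2).exp).mul_const φ
  have ht : 0 ≤ Real.exp (τ₀ / 2) * φ := by positivity
  have h2 := (((hasDerivAt_truncVar ht).comp τ₀ h1).mul_const φ').div_const (L ^ d)
  have h3 := deriv_truncVar_pos ht
  set q := mills (Real.exp (τ₀ / 2) * φ) * ((Real.exp (τ₀ / 2) * φ +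
    mills (Real.exp (τ₀ / 2) * φ)) * (Real.exp (τ₀ / 2) * φ +
    2 * mills (Real.exp (τ₀ / 2) * φ)) - 1)
  refine (by positivity : 0 < q * (Real.exp (τ₀ / 2) * (1 / 2) * φ) * φ' / L ^ d).trans_le ?_
  -- The slope minus the slope with Φ₀ and Φ₀' frozen at τ₀ vanishes at τ₀ and is nonnegative to the
  -- right. Hence a is at least the derivative of the frozen slope, which is explicit and positive;
  -- no derivative of the branch enters.
  have h4 := (h.sub h2).hasDerivWithinAt (s := Ici τ₀)
  rw [hasDerivWithinAt_iff_tendsto_slope, Ici_sdiff_left] at h4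
  refine sub_nonneg.1 (ge_of_tendsto h4 ?_)
  filter_upwards [self_mem_nhdsWithin] with τ hτ
  rw [slope_def_field]
  refine div_nonneg ?_ (sub_nonneg.2 (le_of_lt hτ))
  have h5 := frozen_le_branchSlope (B := B) hΦ hW (le_of_lt hτ : τ₀ ≤ τ)
  simp only [Pi.sub_apply, Function.comp_apply]
  rw [← hφ, ← hφ'] at h5
  have h6 : branchSlope Φ B W τ₀ = truncVar (Real.exp (τ₀ / 2) * φ) * φ' / L ^ d := rfl
  rw [h6]
  linarith

end Response

/-! ### Bifurcation from the homogeneous branch -/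

section Model

variable {d : ℕ} {L : ℝ} {Φ : ℝ → ℝ} {B : ℝ}

/-- The response `(τ, w) ↦ gaussMean (exp τ) (Φ (w + B))` as a continuous function. -/
def responseMap (d : ℕ) (L : ℝ) (B : ℝ) (hΦ : IsActivation Φ) : C(ℝ × ℝ, ℝ) :=
  ⟨fun p => response d L Φ B p.1 p.2, continuous_response hΦ⟩

lemma fderiv_responseMap_snd (hΦ : IsActivation Φ) (τ w t : ℝ) :
    fderiv ℝ (responseMap d L B hΦ) (τ, w) (0, t) = t * responseDeriv d L Φ B τ w := by
  have h1 : HasFDerivAt (responseMap d L B hΦ) (fderiv ℝ (responseMap d L B hΦ) (τ, w)) (τ, w) :=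
    ((contDiff_response hΦ).differentiable two_ne_zero _).hasFDerivAt
  have h2 : HasDerivAt (fun w : ℝ => (τ, w)) (0, 1) w :=
    (hasDerivAt_const w τ).prodMk (hasDerivAt_id w)
  have h3 := (h1.comp_hasDerivAt w h2).unique (hasDerivAt_response hΦ τ w)
  rw [show ((0, t) : ℝ × ℝ) = t • (0, 1) by simp, map_smul, h3, smul_eq_mul]

variable [Fact (0 < L)]

/-- The pair `(τ, W ∗ u)` as a continuous function on the torus. -/
def pairMap (W : L2 d L) : L2 d L × ℝ →L[ℝ] C(Torus d L, ℝ × ℝ) :=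
  ((ContinuousLinearMap.inr ℝ ℝ ℝ).compLeftContinuous ℝ (Torus d L)).comp
      ((convOp W).comp (ContinuousLinearMap.fst ℝ _ _)) +
    ((ContinuousLinearMap.inl ℝ ℝ ℝ).compLeftContinuous ℝ (Torus d L)).comp
      ((ContinuousLinearMap.toSpanSingleton ℝ (1 : C(Torus d L, ℝ))).comp
        (ContinuousLinearMap.snd ℝ _ _))

lemma pairMap_apply (W u : L2 d L) (τ : ℝ) (x : Torus d L) :
    pairMap W (u, τ) x = (τ, convOp W u x) := by
  simp [pairMap]

/-- The map `toL2` as a continuous linear map. -/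
def toL2CLM (d : ℕ) (L : ℝ) [Fact (0 < L)] : C(Torus d L, ℝ) →L[ℝ] L2 d L :=
  ContinuousMap.toLp 2 volume ℝ

/-- The functional `Ḡ`, with the response projected to the functions invariant under `S`. -/
def projGbar (B : ℝ) (hΦ : IsActivation Φ) (W : L2 d L) (S : Set (TorusSymm d L))
    (p : L2 d L × ℝ) : L2 d L :=
  p.1 - (fixedSpace S).starProjection (toL2CLM d L ((responseMap d L B hΦ).comp (pairMap W p)))

/-- The convolution puts the superposition operator on continuous functions, where
`contDiff_postcomp` applies; only afterwards does one return to L². -/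
lemma contDiff_projGbar (hΦ : IsActivation Φ) (W : L2 d L) (S : Set (TorusSymm d L)) :
    ContDiff ℝ 2 (projGbar B hΦ W S) := by
  have h : ContDiff ℝ (2 : ℕ) fun w : C(Torus d L, ℝ × ℝ) => (responseMap d L B hΦ).comp w :=
    contDiff_postcomp 2 (contDiff_response hΦ)
  exact contDiff_fst.sub ((fixedSpace S).starProjection.contDiff.comp
    ((toL2CLM d L).contDiff.comp (h.comp (pairMap W).contDiff)))

lemma convOp_constL2 (W : L2 d L) (c : ℝ) (x : Torus d L) :
    convOp W (constL2 c) x = meanW W * c := by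
  rw [convOp_apply, ← conv_const W c x, conv, conv]
  refine integral_congr_ae ?_
  filter_upwards [Lp.coeFn_const (p := 2) (volume : Measure (Torus d L)) c] with y hy
  rw [constL2, hy]
  rfl

lemma fderiv_projGbar (hΦ : IsActivation Φ) (W : L2 d L) (S : Set (TorusSymm d L)) (r τ : ℝ)
    (y : L2 d L) : fderiv ℝ (projGbar B hΦ W S) (constL2 r, τ) (y, 0) =
      y - responseDeriv d L Φ B τ (meanW W * r) •
        (fixedSpace S).starProjection (toL2 (convOp W y)) := by
  let f' : C(ℝ × ℝ, ℝ × ℝ →L[ℝ] ℝ) := ⟨fderiv ℝ (responseMap d L B hΦ),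
    (contDiff_response hΦ).continuous_fderiv two_ne_zero⟩
  have h1 := hasFDerivAt_postcomp (K := Torus d L) (f := responseMap d L B hΦ) (f' := f')
    (fun p => ((contDiff_response hΦ).differentiable two_ne_zero p).hasFDerivAt)
    (pairMap W (constL2 r, τ))
  have h2 : HasFDerivAt (projGbar B hΦ W S) _ (constL2 r, τ) :=
    hasFDerivAt_fst.sub ((fixedSpace S).starProjection.hasFDerivAt.comp (constL2 r, τ)
      ((toL2CLM d L).hasFDerivAt.comp (constL2 r, τ)
        (h1.comp (constL2 r, τ) (pairMap W).hasFDerivAt)))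
  have h3 : pointwiseApply (Torus d L) (ℝ × ℝ) ℝ (f'.comp (pairMap W (constL2 r, τ)))
      (pairMap W (y, 0)) = responseDeriv d L Φ B τ (meanW W * r) • convOp W y := by
    ext x
    rw [pointwiseApply_apply, ContinuousMap.comp_apply, pairMap_apply, pairMap_apply,
      convOp_constL2, ContinuousMap.smul_apply, smul_eq_mul]
    exact (fderiv_responseMap_snd hΦ τ _ _).trans (mul_comm _ _)
  rw [h2.fderiv]
  simp only [sub_apply, ContinuousLinearMap.comp_apply, ContinuousLinearMap.coe_fst']
  rw [h3, map_smul, map_smul]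
  rfl

lemma isZero_exp_iff (hΦ : IsActivation Φ) {W u : L2 d L} {τ : ℝ} :
    IsZero Φ B W u (Real.exp τ) ↔
      u = toL2 ((responseMap d L B hΦ).comp (pairMap W (u, τ))) := by
  have h := coeFn_toL2 ((responseMap d L B hΦ).comp (pairMap W (u, τ)))
  have e : ∀ x, Gbar Φ B W u (Real.exp τ) x =
      u x - ((responseMap d L B hΦ).comp (pairMap W (u, τ))) x := by
    intro x
    rw [ContinuousMap.comp_apply, pairMap_apply, convOp_apply]
    rfl
  constructor
  · intro hz
    refine Lp.ext ?_
    filter_upwards [hz, h] with x hx hx'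
    rw [e] at hx
    rw [hx']
    exact sub_eq_zero.1 hx
  · intro hu
    rw [← hu] at h
    filter_upwards [h] with x hx
    rw [e, hx, sub_self]
    rfl

/-- A zero equals a projection onto the fixed space and so lies in it, and there the response is
already invariant. The symmetric problem can thus be solved in all of L². -/
lemma projGbar_eq_zero_iff (hΦ : IsActivation Φ) {W : L2 d L} {S : Set (TorusSymm d L)}
    (hW : W ∈ fixedSpace S) {u : L2 d L} {τ : ℝ} : projGbar B hΦ W S (u, τ) = 0 ↔
      u ∈ fixedSpace S ∧ IsZero Φ B W u (Real.exp τ) := by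
  have hmem : u ∈ fixedSpace S →
      toL2 ((responseMap d L B hΦ).comp (pairMap W (u, τ))) ∈ fixedSpace S := by
    intro hu
    refine toL2_mem_fixedSpace fun σ hσ x => ?_
    simp only [ContinuousMap.comp_apply, pairMap_apply, convOp_comp_symm hW hu hσ]
  rw [projGbar, sub_eq_zero, isZero_exp_iff hΦ]
  constructor
  · intro h
    simp only at h
    have hu : u ∈ fixedSpace S := by
      rw [h]; exact Submodule.starProjection_apply_mem _ _
    exact ⟨hu, h.trans (Submodule.starProjection_eq_self_iff.2 (hmem hu))⟩
  · rintro ⟨hu, h⟩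
    exact h.trans (Submodule.starProjection_eq_self_iff.2 (hmem hu)).symm

lemma isZero_rhoInf (hΦ : IsActivation Φ) {W : L2 d L} (hW : meanW W < 0) (τ : ℝ) :
    IsZero Φ B W (constL2 (rhoInf Φ B W (Real.exp τ))) (Real.exp τ) := by
  rw [isZero_exp_iff hΦ, ← toL2_const]
  congr 1
  ext x
  rw [toL2_const, ContinuousMap.comp_apply, pairMap_apply, convOp_constL2]
  exact rhoInf_eq hΦ hW τ

lemma continuous_constL2 : Continuous (constL2 : ℝ → L2 d L) :=
  (Lp.constL 2 (volume : Measure (Torus d L)) ℝ (E := ℝ)).continuous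

/-- Bifurcation at a simple mode of the convolution operator on a space of invariant functions. -/
theorem isBifurcationPoint_of_simple_mode (hΦ : IsActivation Φ) {W : L2 d L} (hW₀ : meanW W < 0)
    {S : Set (TorusSymm d L)} (hW : W ∈ fixedSpace S) {w : C(Torus d L, ℝ)}
    (hw : toL2 w ∈ fixedSpace S) (hw0 : toL2 w ≠ 0) (hint : ∫ x, w x = 0) {lam : ℝ}
    (hT : convOp W (toL2 w) = lam • w)
    (hT' : ∀ v, inner ℝ (toL2 w) (toL2 (convOp W v)) = lam * inner ℝ (toL2 w) v)
    (hker : ∀ v ∈ fixedSpace S, toL2 (convOp W v) = lam • v → inner ℝ (toL2 w) v = 0 → v = 0)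
    {τ₀ : ℝ} (hτ₀ : lam * branchSlope Φ B W τ₀ = 1) :
    IsBifurcationPoint (fixedSpace S : Set (L2 d L)) Φ B W (toL2 w) (Real.exp τ₀) := by
  set ω : L2 d L := toL2 w with hωdef
  set P := (fixedSpace S).starProjection with hP
  have hn : ‖ω‖ ^ 2 ≠ 0 := pow_ne_zero _ (norm_ne_zero_iff.2 hw0)
  let ℓ : L2 d L →L[ℝ] ℝ := (‖ω‖ ^ 2)⁻¹ • innerSL ℝ ω
  have hℓ : ∀ v, ℓ v = (‖ω‖ ^ 2)⁻¹ * inner ℝ ω v := fun v => rfl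
  have hℓω : ℓ ω = 1 := by rw [hℓ, real_inner_self_eq_norm_sq, inv_mul_cancel₀ hn]
  have hℓc : ∀ c : ℝ, ℓ (constL2 c) = 0 := by
    intro c
    rw [hℓ, inner_toL2_const, hint, mul_zero, mul_zero]
  -- The projection is self-adjoint and fixes ω.
  have hℓP : ∀ v, ℓ (P v) = ℓ v := by
    intro v
    rw [hℓ, hℓ, hP, ← Submodule.inner_starProjection_left_eq_right,
      Submodule.starProjection_eq_self_iff.2 hw]
  have hℓT : ∀ v, ℓ (P (toL2 (convOp W v))) = lam * ℓ v := by
    intro v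
    rw [hℓP, hℓ, hT', hℓ]; ring
  set c := branchSlope Φ B W τ₀ with hc
  have hlam : lam ≠ 0 := left_ne_zero_of_mul_eq_one hτ₀
  have hc0 : 0 < c := (branchSlope_nonneg hΦ τ₀).lt_of_ne' (right_ne_zero_of_mul_eq_one hτ₀)
  have hD : ∀ τ y, fderiv ℝ (projGbar B hΦ W S) (constL2 (rhoInf Φ B W (Real.exp τ)), τ) (y, 0) =
      y - branchSlope Φ B W τ • P (toL2 (convOp W y)) := fun τ y => fderiv_projGbar hΦ W S _ τ y
  -- the inverse of the augmented linearisation, by the Fredholm alternative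
  let T : L2 d L →L[ℝ] L2 d L := c • P.comp ((toL2CLM d L).comp (convOp W)) - ℓ.smulRight ω
  have hTv : ∀ v, T v = c • P (toL2 (convOp W v)) - ℓ v • ω := fun v => rfl
  have hTc : IsCompactOperator T := by
    have h1 : IsCompactOperator (c • P.comp ((toL2CLM d L).comp (convOp W))) :=
      (((isCompactOperator_convOp W).clm_comp (toL2CLM d L)).clm_comp P).smul c
    have h2 : IsCompactOperator (ℓ.smulRight ω) := by
      exact (isCompactOperator_of_locallyCompactSpace_rng
        (ContinuousLinearMap.toSpanSingleton ℝ ω)).comp_clm ℓ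
    exact h1.sub h2
  have hres : (1 : ℝ) ∈ resolventSet ℝ T := by
    -- An eigenvector v of `T` for 1 is invariant, being a combination of ω and a projected vector.
    -- Applying ℓ, with lam · c = 1, gives ℓ v = 0; then v is an eigenvector of the convolution
    -- orthogonal to ω, and simplicity makes it zero.
    refine (hTc.hasEigenvalue_or_mem_resolventSet one_ne_zero).resolve_left fun hev => ?_
    obtain ⟨v, hv⟩ := hev.exists_hasEigenvector
    refine hv.2 ?_
    have h1 : c • P (toL2 (convOp W v)) - ℓ v • ω = v := by
      have := hv.apply_eq_smul
      rwa [one_smul] at this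
    have hvS : v ∈ fixedSpace S := by
      rw [← h1]
      exact Submodule.sub_mem _ (Submodule.smul_mem _ _ (Submodule.starProjection_apply_mem _ _))
        (Submodule.smul_mem _ _ hw)
    have h2 : ℓ v = 0 := by
      have h3 := congrArg ℓ h1
      rw [map_sub, map_smul, map_smul, hℓT, hℓω, smul_eq_mul, smul_eq_mul] at h3
      linear_combination (-1 : ℝ) * h3 + ℓ v * hτ₀
    have h3 : P (toL2 (convOp W v)) = toL2 (convOp W v) :=
      Submodule.starProjection_eq_self_iff.2 (toL2_convOp_mem hW hvS)
    rw [h2, zero_smul, sub_zero, h3] at h1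
    refine hker v hvS ?_ ?_
    · conv_rhs => rw [← h1]
      rw [smul_smul, hτ₀, one_smul]
    · rw [hℓ] at h2
      exact (mul_eq_zero.1 h2).resolve_left (inv_ne_zero hn)
  rw [spectrum.mem_resolventSet_iff, map_one] at hres
  obtain ⟨E', hE'⟩ := hres
  let E : L2 d L ≃L[ℝ] L2 d L := ContinuousLinearEquiv.unitsEquiv ℝ (L2 d L) E'
  have hE : ∀ y, E y = y - T y := fun y => by
    have : E y = (E' : L2 d L →L[ℝ] L2 d L) y := rfl
    rw [this, hE']
    rfl
  obtain ⟨δ, u, τ, hδ, huC, hτC, hu0, hτ0, hsol, ho, hU⟩ :=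
    exists_bifurcating_curve (contDiff_projGbar (B := B) hΦ W S)
      (ρ := fun τ => constL2 (rhoInf Φ B W (Real.exp τ))) (b := τ₀)
      (continuous_constL2.comp (continuous_rhoInf_exp hΦ hW₀)).continuousAt
      (fun τ => (projGbar_eq_zero_iff hΦ hW).2
        ⟨constL2_mem_fixedSpace S _, isZero_rhoInf hΦ hW₀ τ⟩)
      hℓω (fun τ => hℓc _) (μ := fun τ => 1 - lam * branchSlope Φ B W τ)
      (fun τ y => by rw [hD, map_sub, map_smul, hℓT, smul_eq_mul]; ring)
      (fun a ha => by
        have h1 : HasDerivAt (branchSlope Φ B W) (-a / lam) τ₀ := by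
          have := (ha.const_sub 1).div_const lam
          refine this.congr_of_eventuallyEq (Eventually.of_forall fun τ => ?_)
          field_simp
          ring
        rintro rfl
        have := hasDerivAt_branchSlope_pos hΦ hW₀ hc0 h1
        simp at this)
      (by
        rw [hD, hT]
        have h1 : toL2 (lam • w) = lam • ω := map_smul (toL2CLM d L) lam w
        rw [h1, map_smul, Submodule.starProjection_eq_self_iff.2 hw, smul_smul, mul_comm, hτ₀,
          one_smul, sub_self])
      E (fun y => by rw [hE, hTv, hD]; abel)
  refine ⟨δ, u, fun z => Real.exp (τ z), hδ, huC, Real.contDiff_exp.comp_contDiffOn hτC, hu0,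
    by simp only [hτ0], fun z hz => ⟨Real.exp_pos _, ?_⟩, fun z hz hz0 e he => hz0 ?_, ho, ?_⟩
  · exact (projGbar_eq_zero_iff hΦ hW).1 (hsol z hz).1
  -- The ℓ-coordinate of u(z) is z, while that of a constant is 0.
  · rw [← (hsol z hz).2, he, hℓc]
  · have ht : Tendsto (fun p : L2 d L × ℝ => (p.1, Real.log p.2))
        (𝓝 (constL2 (rhoInf Φ B W (Real.exp τ₀)), Real.exp τ₀))
        (𝓝 (constL2 (rhoInf Φ B W (Real.exp τ₀)), τ₀)) := by
      have h1 : ContinuousAt (fun p : L2 d L × ℝ => (p.1, Real.log p.2))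
          (constL2 (rhoInf Φ B W (Real.exp τ₀)), Real.exp τ₀) :=
        continuousAt_fst.prodMk (continuousAt_snd.log (Real.exp_pos τ₀).ne')
      have h2 := h1.tendsto
      simpa only [Real.log_exp] using h2
    refine ⟨_, ht.eventually hU, fun p hp hpX hp2 hpz => ?_⟩
    have h1 : projGbar B hΦ W S (p.1, Real.log p.2) = 0 :=
      (projGbar_eq_zero_iff hΦ hW).2 ⟨hpX, by rwa [Real.exp_log hp2]⟩
    rcases hp h1 with h2 | ⟨z, hz, h2⟩
    · left
      simpa only [Real.exp_log hp2] using h2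
    · right
      have h3 : Real.log p.2 = τ z := congrArg Prod.snd h2
      have h4 : p.1 = u z := congrArg Prod.fst h2
      refine ⟨z, hz, Prod.ext h4 ?_⟩
      show p.2 = Real.exp (τ z)
      rw [← h3, Real.exp_log hp2]

/-- Pairing the eigenvalue equation with ω_l produces both eigenvalues in front of the same inner
product. -/
lemma inner_omega_eq_zero_of_eigen {W v : L2 d L} (hW : W ∈ L2S d L) {k l : Fin d → ℕ}
    (hv : toL2 (convOp W v) = (L ^ ((d : ℝ) / 2) * modeRatio W k) • v)
    (hkl : modeRatio W k ≠ modeRatio W l) : inner ℝ (toL2 (omega l)) v = 0 := by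
  have h := inner_toL2_convOp_omega hW v l
  rw [hv, inner_smul_right] at h
  by_contra h0
  have h1 := mul_right_cancel₀ h0 h
  exact hkl (mul_left_cancel₀ (rpow_half_pos (d := d) (L := L)).ne' h1)

theorem isBifurcationPoint_omega (hΦ : IsActivation Φ) {W : L2 d L} (hW : W ∈ L2S d L)
    (hW₀ : meanW W < 0) {k : Fin d → ℕ} (hk : k ≠ 0) {τ : ℝ}
    (hτ : L ^ ((d : ℝ) / 2) * modeRatio W k * branchSlope Φ B W τ = 1)
    (hl : ∀ l : Fin d → ℕ, l ≠ k → modeRatio W k ≠ modeRatio W l) :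
    IsBifurcationPoint (L2S d L) Φ B W (toL2 (omega k)) (Real.exp τ) := by
  rw [← coe_fixedSpace_flip] at hW ⊢
  refine isBifurcationPoint_of_simple_mode hΦ hW₀ hW (toL2_omega_mem k)
    (toL2_ne_zero 0 (omega_zero_pos k).ne') (integral_omega hk) ?_ ?_ ?_ hτ
  · exact convOp_omega (coe_fixedSpace_flip (d := d) (L := L) ▸ hW) k
  · exact fun v => inner_toL2_convOp_omega (coe_fixedSpace_flip (d := d) (L := L) ▸ hW) v k
  · intro v hv hTv h0
    rw [← SetLike.mem_coe, coe_fixedSpace_flip] at hv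
    rw [coe_fixedSpace_flip] at hW
    refine eq_zero_of_inner_omega hv fun l => ?_
    by_cases h : l = k
    · rw [h, h0]
    · exact inner_omega_eq_zero_of_eigen hW hTv (hl l h)

/-- All permutations of k share one eigenvalue, but an exchangeable function has equal coefficients
along them, so they contribute the single direction ω_[k]. -/
theorem isBifurcationPoint_omegaEx (hΦ : IsActivation Φ) {W : L2 d L} (hW : W ∈ L2ex d L)
    (hW₀ : meanW W < 0) {k : Fin d → ℕ} (hk : k ≠ 0) {τ : ℝ}
    (hτ : L ^ ((d : ℝ) / 2) * modeRatio W k * branchSlope Φ B W τ = 1)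
    (hl : ∀ l : Fin d → ℕ, l ∉ permClass k → modeRatio W k ≠ modeRatio W l) :
    IsBifurcationPoint (L2ex d L) Φ B W (toL2 (omegaEx k)) (Real.exp τ) := by
  have hW' := hW
  rw [← coe_fixedSpace_flip_perm] at hW' ⊢
  refine isBifurcationPoint_of_simple_mode hΦ hW₀ hW' (toL2_omegaEx_mem k)
    (toL2_ne_zero 0 (omegaEx_zero_pos k).ne') (integral_omegaEx hk) (convOp_omegaEx hW k)
    (fun v => inner_toL2_convOp_omegaEx hW v k) ?_ hτ
  intro v hv hTv h0
  rw [← SetLike.mem_coe, coe_fixedSpace_flip_perm] at hv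
  refine eq_zero_of_inner_omega hv.1 fun l => ?_
  by_cases h : l ∈ permClass k
  · exact inner_omega_eq_zero_of_inner_omegaEx hv h h0
  · exact inner_omega_eq_zero_of_eigen hW.1 hTv (hl l h)

end Model

end NeuralField

end

/-! ### Existence, uniqueness and order of the bifurcation values -/

theorem theorem3p11 (d : ℕ) (L : ℝ) [Fact (0 < L)] (Φ : ℝ → ℝ) (B : ℝ) (W : L2 d L)
    (hΦ : ContDiff ℝ 2 Φ) (hconvex : ∀ x, 0 ≤ iteratedDeriv 2 Φ x)
    (hmono : StrictMonoOn Φ (Ici 0)) (hneg : ∀ x ≤ 0, Φ x = 0)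
    (hB : 0 < B) (hW : W ∈ L2S d L) (hW₀ : meanW W < 0) :
    (∀ κ, 0 < κ → ∃! r, IsHomogeneousMean Φ B W κ r) ∧
    ∃ ρstar : ℝ,
      Tendsto (rhoInf Φ B W) atTop (𝓝 ρstar) ∧
      0 < deriv Φ (meanW W * ρstar + B) ∧
      (∀ k : Fin d → ℕ, k ≠ 0 →
        ExceedsThreshold Φ B W ρstar k →
        (∀ l : Fin d → ℕ, l ≠ k →
          modeRatio W k ≠ modeRatio W l ∨ (W ∈ L2ex d L ∧ l ∈ permClass k)) →
        ∃ κ : ℝ,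
          2 * |meanW W| ^ 2 / (L ^ (2 * d) * Real.pi * B ^ 2) < κ ∧
          BifurcationCondition Φ B W k κ ∧
          (∀ κ', 0 < κ' → BifurcationCondition Φ B W k κ' → κ' = κ) ∧
          ((∀ l : Fin d → ℕ, l ≠ k → modeRatio W k ≠ modeRatio W l) →
            IsBifurcationPoint (L2S d L) Φ B W (toL2 (omega k)) κ) ∧
          (W ∈ L2ex d L →
            IsBifurcationPoint (L2ex d L) Φ B W (toL2 (omegaEx k)) κ)) ∧
      (∀ (k l : Fin d → ℕ) (κ κ' : ℝ), 0 < κ → 0 < κ' →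
        ExceedsThreshold Φ B W ρstar k → ExceedsThreshold Φ B W ρstar l →
        BifurcationCondition Φ B W k κ → BifurcationCondition Φ B W l κ' →
        modeRatio W l < modeRatio W k → κ < κ') := by
  have hact : IsActivation Φ := ⟨hΦ, hconvex, hmono, hneg⟩
  have hL : 0 < L ^ d := pow_pos_of_fact
  have hL2 : 0 < L ^ ((d : ℝ) / 2) := rpow_half_pos
  obtain ⟨r, hr, hrpos, hslope⟩ := exists_tendsto_rhoInf_exp (W := W) hact hW₀ hB
  have hr' : 0 < deriv Φ (meanW W * r + B) := hact.deriv_pos hrpos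
  refine ⟨fun κ hκ => existsUnique_isHomogeneousMean hact hW₀ hκ, r, ?_, hr', ?_, ?_⟩
  · refine (hr.comp Real.tendsto_log_atTop).congr' ?_
    filter_upwards [eventually_gt_atTop 0] with κ hκ
    simp only [Function.comp_apply, Real.exp_log hκ]
  · intro k hk hthr hl
    set lam := L ^ ((d : ℝ) / 2) * modeRatio W k with hlamdef
    have hlam : L ^ d / deriv Φ (meanW W * r + B) < lam := by
      rw [hlamdef, ← rpow_half_mul_self, mul_div_assoc]
      exact mul_lt_mul_of_pos_left hthr hL2
    have hlam0 : 0 < lam := (div_pos hL hr').trans hlam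
    have hlt : 1 / lam < deriv Φ (meanW W * r + B) / L ^ d := by
      rw [div_lt_iff₀ hr'] at hlam
      rw [div_lt_div_iff₀ hlam0 hL]
      linarith
    -- The threshold says exactly that the critical slope 1/lam lies below the limit of the slope.
    -- Since the slope also vanishes somewhere, the intermediate value theorem applies.
    obtain ⟨τ₁, hτ₁⟩ := (hslope.eventually (lt_mem_nhds hlt)).exists
    obtain ⟨τ₂, hτ₂⟩ := exists_branchSlope_eq_zero (W := W) hact hW₀ hB
    obtain ⟨τ, hτ⟩ := mem_range_of_exists_le_of_exists_ge
      (continuous_branchSlope (B := B) (W := W) hact hW₀)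
      ⟨τ₂, hτ₂.trans_le (one_div_pos.2 hlam0).le⟩ ⟨τ₁, hτ₁.le⟩
    have hpos : 0 < branchSlope Φ B W τ := hτ ▸ one_div_pos.2 hlam0
    have hτ' : lam * branchSlope Φ B W τ = 1 := by rw [hτ, mul_one_div_cancel hlam0.ne']
    refine ⟨Real.exp τ, lt_exp_of_branchSlope_pos hact hW₀ hB hpos,
      (bifurcationCondition_iff hact hW₀ k τ).2 ⟨hpos.ne', hτ'⟩, ?_,
      isBifurcationPoint_omega hact hW hW₀ hk hτ', fun hWex =>
      isBifurcationPoint_omegaEx hact hWex hW₀ hk hτ' fun l hlk => ?_⟩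
    · intro κ' hκ' hb
      rw [← Real.exp_log hκ', bifurcationCondition_iff hact hW₀] at hb
      have heq : branchSlope Φ B W (Real.log κ') = branchSlope Φ B W τ :=
        mul_left_cancel₀ hlam0.ne' (hb.2.trans hτ'.symm)
      rw [← Real.exp_log hκ']
      congr 1
      rcases lt_trichotomy (Real.log κ') τ with h | h | h
      · exact absurd heq (branchSlope_lt hact hW₀ h (heq ▸ hpos)).ne
      · exact h
      · exact absurd heq (branchSlope_lt hact hW₀ h hpos).ne'
    · have hne : l ≠ k := fun h => hlk (h ▸ self_mem_permClass k)
      exact (hl l hne).resolve_right fun h => hlk h.2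
  · intro k l κ κ' hκ hκ' _ hthr hbk hbl hlt
    -- If κ' ≤ κ, the slope at κ' is at most that at κ; with the larger ratio for k, the two
    -- products could not agree.
    by_contra hle
    have hpos : 0 < modeRatio W l := (div_pos hL2 hr').trans hthr
    rw [← Real.exp_log hκ, bifurcationCondition_iff hact hW₀] at hbk
    rw [← Real.exp_log hκ', bifurcationCondition_iff hact hW₀] at hbl
    have h1 := monotone_branchSlope (B := B) (W := W) hact hW₀
      (Real.log_le_log hκ' (not_lt.1 hle))
    have h2 : 0 < branchSlope Φ B W (Real.log κ') :=
      (branchSlope_nonneg hact _).lt_of_ne' hbl.1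
    have h3 := hbl.2.trans hbk.2.symm
    rw [mul_assoc, mul_assoc] at h3
    have h4 := mul_left_cancel₀ hL2.ne' h3
    nlinarith
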